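/- Let $Y$ be a locally compact Hadamard space (a non-empty complete geodesic metric space that satisfies the CAT(0) triangle comparison). Let $\partial_\infty Y$ be its ideal boundary, i.e. the set of asymptote classes of unit speed geodesic rays. Equip it with the Tits angle metric $\angle_{Tits}(\xi,\eta)=\sup_{x\in Y}\angle_x(\xi,\eta)$. For $C\subseteq Y$ let $\partial_\infty C\subseteq\partial_\infty Y$ be the set of endpoints of rays contained in $C$. A unit sphere in $\partial_\infty Y$ is a subset isometric, for the Tits metric, to a round unit sphere $S^d$, $d\ge 0$, with its angular metric. It bounds a unit hemisphere if there is a Tits-isometric embedding of a closed hemisphere of $S^{d+1}$ into $\partial_\infty Y$ that maps the boundary of the hemisphere onto the given sphere. For $A\subseteq\partial_\infty Y$ let $\mathcal C_A$ be the family of non-empty closed convex subsets $C\subseteq Y$ with $\partial_\infty C\supseteq A$, ordered by inclusion. Consider the condition $(*)$ there is a unit sphere $s\subseteq A$ that does not bound a unit hemisphere. 1. If $(*)$ holds, then $\mathcal C_A$ has a minimal element. 2. Suppose that $\mathcal C_A$ has minimal elements. Then the union $Y_0$ of all of them is a convex subset of $Y$. For every minimal element $C$ there are a Hadamard space $Z$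 and an isometry from the metric product $C\times Z$ (with the $\ell^2$ product metric) onto $Y_0$ whose layers, the images of the sets $C\times\{z\}$ with $z\in Z$, are precisely the minimal elements of $\mathcal C_A$. The space $Z$ is compact if $(*)$ holds or if $A=\partial_\infty Y$. 3. A central minimal convex subset in $\mathcal C_A$ is the layer over a center $z_0$ of $Z$ (the center of a closed ball of least radius containing $Z$), for some isometry of a product $C\times Z$ of a Hadamard space $C$ and a compact Hadamard space $Z$ with $Y_0$ whose layers are precisely the minimal elements. If $(*)$ holds, there is exactly one central minimal convex subset in $\mathcal C_A$. If $\mathcal C_{\partial_\infty Y}$ has minimal elements, there is exactly one central minimal convex subset in $\mathcal C_{\partial_\infty Y}$, i.e. $Y$ has a well-defined convex core. -/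

import Mathlib

open Set Filter Topology
open scoped NNReal

universe u

/-- `Y` is a Hadamard space: a non-empty complete geodesic metric space all of whose geodesic
triangles are at least as thin as their comparison triangles in the Euclidean plane.
In a geodesic space, `p` lies on a geodesic segment from `x` to `y` if and only if
`dist x p + dist p y = dist x y`. -/
structure IsHadamard (Y : Type u) [MetricSpace Y] : Prop where
  nonempty : Nonempty Y
  complete : CompleteSpace Y
  geodesic : ∀ x y : Y, ∃ γ : ℝ → Y, γ 0 = x ∧ γ (dist x y) = y ∧
    ∀ s ∈ Icc (0 : ℝ) (dist x y), ∀ t ∈ Icc (0 : ℝ) (dist x y), dist (γ s) (γ t) = |s - t|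
  comparison : ∀ x y z p q : Y,
    dist x p + dist p y = dist x y → dist x q + dist q z = dist x z →
    ∀ x' y' z' p' q' : EuclideanSpace ℝ (Fin 2),
      dist x' y' = dist x y → dist y' z' = dist y z → dist x' z' = dist x z →
      dist x' p' = dist x p → dist p' y' = dist p y →
      dist x' q' = dist x q → dist q' z' = dist q z →
      dist p q ≤ dist p' q'

/-- Geodesic convexity: `C` contains every geodesic segment of the ambient space between any two
of its points. -/
def GeodConvex {Y : Type u} [MetricSpace Y] (C : Set Y) : Prop :=
  ∀ x ∈ C, ∀ y ∈ C, ∀ p : Y, dist x p + dist p y = dist x y → p ∈ C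

/-- Unit speed geodesic rays `[0,∞) → Y`. -/
def GeodesicRay (Y : Type u) [MetricSpace Y] : Type u :=
  {ρ : ℝ≥0 → Y // Isometry ρ}

/-- Two rays are asymptotic if they stay at bounded distance. -/
def Asymptotic {Y : Type u} [MetricSpace Y] (ρ σ : GeodesicRay Y) : Prop :=
  ∃ K : ℝ, ∀ t : ℝ≥0, dist (ρ.1 t) (σ.1 t) ≤ K

/-- The equivalence relation of being asymptotic. -/
def asymptoticSetoid (Y : Type u) [MetricSpace Y] : Setoid (GeodesicRay Y) where
  r := Asymptotic
  iseqv :=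
    { refl := fun ρ => ⟨0, fun t => by simp⟩
      symm := fun ⟨K, hK⟩ => ⟨K, fun t => by rw [dist_comm]; exact hK t⟩
      trans := fun ⟨K, hK⟩ ⟨L, hL⟩ =>
        ⟨K + L, fun t => (dist_triangle _ _ _).trans (add_le_add (hK t) (hL t))⟩ }

/-- The ideal (geometric) boundary of `Y`: asymptote classes of geodesic rays. -/
def IdealBoundary (Y : Type u) [MetricSpace Y] : Type u :=
  Quotient (asymptoticSetoid Y)

/-- The ideal endpoint of a ray. -/
def GeodesicRay.endpoint {Y : Type u} [MetricSpace Y] (ρ : GeodesicRay Y) : IdealBoundary Y :=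
  Quotient.mk (asymptoticSetoid Y) ρ

/-- The ideal boundary of a subset `C` of `Y`, as a subset of the ideal boundary of `Y`: the
endpoints of the rays contained in `C`. -/
def idealBoundaryOf {Y : Type u} [MetricSpace Y] (C : Set Y) : Set (IdealBoundary Y) :=
  {ξ | ∃ ρ : GeodesicRay Y, (∀ t, ρ.1 t ∈ C) ∧ ρ.endpoint = ξ}

/-- The angle at the vertex `p'` of a Euclidean comparison triangle for `p, x, y`. -/
noncomputable def comparisonAngle {Y : Type u} [MetricSpace Y] (p x y : Y) : ℝ :=
  Real.arccos ((dist p x ^ 2 + dist p y ^ 2 - dist x y ^ 2) / (2 * dist p x * dist p y))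

/-- The (Alexandrov) angle at the initial point between two rays with the same initial point. -/
noncomputable def rayAngle {Y : Type u} [MetricSpace Y] (ρ σ : GeodesicRay Y) : ℝ :=
  limsup (fun q : ℝ≥0 × ℝ≥0 => comparisonAngle (ρ.1 0) (ρ.1 q.1) (σ.1 q.2))
    (𝓝[>] (0 : ℝ≥0) ×ˢ 𝓝[>] (0 : ℝ≥0))

/-- The Tits angle of two ideal points: the supremum, over all points `x` of `Y`, of the visual
angle at `x` between the rays from `x` to the two ideal points. -/
noncomputable def titsAngle {Y : Type u} [MetricSpace Y] (ξ η : IdealBoundary Y) : ℝ :=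
  sSup {θ : ℝ | ∃ ρ σ : GeodesicRay Y, ρ.1 0 = σ.1 0 ∧ ρ.endpoint = ξ ∧ σ.endpoint = η ∧
    θ = rayAngle ρ σ}

/-- `f` preserves distances on the set `D` of unit vectors of a Euclidean space, where `D` carries
the angular metric and the ideal boundary carries the Tits angle metric. -/
def TitsIsometricOn {Y : Type u} [MetricSpace Y] {n : ℕ}
    (f : EuclideanSpace ℝ (Fin n) → IdealBoundary Y) (D : Set (EuclideanSpace ℝ (Fin n))) : Prop :=
  ∀ u ∈ D, ∀ v ∈ D, titsAngle (f u) (f v) = InnerProductGeometry.angle u v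

/-- `s` is a unit sphere of some dimension `d ≥ 0` with respect to the Tits metric. -/
def IsUnitSphere {Y : Type u} [MetricSpace Y] (s : Set (IdealBoundary Y)) : Prop :=
  ∃ (d : ℕ) (f : EuclideanSpace ℝ (Fin (d + 1)) → IdealBoundary Y),
    TitsIsometricOn f (Metric.sphere 0 1) ∧ f '' Metric.sphere 0 1 = s

/-- `s` bounds a unit hemisphere: `s` is the boundary sphere of a subset of the ideal boundary that
is isometric, for the Tits metric, to a closed hemisphere of a unit sphere of dimension `d + 1`. -/
def BoundsUnitHemisphere {Y : Type u} [MetricSpace Y] (s : Set (IdealBoundary Y)) : Prop :=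
  ∃ (d : ℕ) (f : EuclideanSpace ℝ (Fin (d + 2)) → IdealBoundary Y),
    TitsIsometricOn f {v | ‖v‖ = 1 ∧ 0 ≤ v (Fin.last (d + 1))} ∧
    f '' {v | ‖v‖ = 1 ∧ v (Fin.last (d + 1)) = 0} = s

/-- The family of non-empty closed convex subsets whose ideal boundary contains `A`. -/
def convexFamily {Y : Type u} [MetricSpace Y] (A : Set (IdealBoundary Y)) : Set (Set Y) :=
  {C | C.Nonempty ∧ IsClosed C ∧ GeodConvex C ∧ A ⊆ idealBoundaryOf C}

/-- `C` is a minimal element, for inclusion, of the family of `A`. -/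
def IsMinimalFor {Y : Type u} [MetricSpace Y] (A : Set (IdealBoundary Y)) (C : Set Y) : Prop :=
  Minimal (fun D => D ∈ convexFamily A) C

/-- The union of all minimal elements of the family of `A`. -/
def minimalUnion {Y : Type u} [MetricSpace Y] (A : Set (IdealBoundary Y)) : Set Y :=
  ⋃₀ {C | IsMinimalFor A C}

/-- The layer `C × {z}` of a metric product decomposition of the subset `S` of `Y`. -/
def productLayer {Y C Z : Type u} [MetricSpace Y] [MetricSpace C] [MetricSpace Z] {S : Set Y}
    (φ : WithLp 2 (C × Z) ≃ᵢ S) (z : Z) : Set Y :=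
  range fun c : C => (φ (WithLp.toLp 2 (c, z)) : Y)

/-- The identification `φ` of the metric product `C × Z` with the union of the minimal elements has
as its layers `C × {z}` precisely the minimal elements. -/
def LayersAreMinimal {Y C Z : Type u} [MetricSpace Y] [MetricSpace C] [MetricSpace Z]
    (A : Set (IdealBoundary Y)) (φ : WithLp 2 (C × Z) ≃ᵢ minimalUnion A) : Prop :=
  ∀ K : Set Y, IsMinimalFor A K ↔ ∃ z : Z, K = productLayer φ z

/-- `z₀` is a center of the bounded space `Z`: the center of a closed ball of least radius
containing `Z`. -/
def IsCenter {Z : Type u} [MetricSpace Z] (z₀ : Z) : Prop :=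
  ∀ (z : Z) (r : ℝ), (∀ w, dist z w ≤ r) → ∀ w, dist z₀ w ≤ r

/-- `K` is a central minimal convex subset: the layer `C × {z₀}` over a center `z₀` of `Z` in a
decomposition `C × Z`, with `Z` a compact Hadamard space, of the union of the minimal elements,
whose layers are precisely the minimal elements. -/
def IsCentralMinimal {Y : Type u} [MetricSpace Y] (A : Set (IdealBoundary Y)) (K : Set Y) : Prop :=
  ∃ (C Z : Type u) (_ : MetricSpace C) (_ : MetricSpace Z)
    (φ : WithLp 2 (C × Z) ≃ᵢ minimalUnion A) (z₀ : Z),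
    IsHadamard C ∧ IsHadamard Z ∧ CompactSpace Z ∧ LayersAreMinimal A φ ∧
    IsCenter z₀ ∧ K = productLayer φ z₀

/-- `K` is the convex core of `Y`: the central minimal convex subset for the whole ideal
boundary. -/
def IsConvexCore {Y : Type u} [MetricSpace Y] (K : Set Y) : Prop :=
  IsCentralMinimal (univ : Set (IdealBoundary Y)) K

/-!
Everything is derived from the Stewart inequality `IsHadamard.stewart` for the distance from a
point to the points of a segment, and from the quadrilateral inequality that follows from it. By
local compactness the space is proper (`IsHadamard.properSpace`).

*Structure of the minimal elements.* If `K` is minimal, then a closed convex subset of `K` that no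
ray with endpoint in `A` leaves is all of `K`. A function that is convex, and bounded along such
rays, does not increase along them, so they do not leave its sublevel sets and it is constant on
`K`. Applied to the distance from a
second minimal element `L`, this shows that `K` and `L` are parallel, and the quadrilateral
inequality then makes the Pythagorean inequalities between them equalities (`IsParallel.dist_sq`).
The set of points at parameter `t` between `K` and `L` is again minimal, so the union of the
minimal elements is convex. Projecting around three minimal elements is an isometry of the first
one, whose displacement is a convex function and hence a constant `δ`. If `δ` were positive, then
a path through all three sets would be shorter than its endpoints allow
(`IsParallel.displacement_eq_zero`). Therefore the projections between minimal elements compose,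
and they identify the union with the product of a minimal element `C` and a slice, the set of
points that project to a given point of `C` (`IsMinimalFor.exists_product`). The slice is a closed
convex subset, since limits of minimal elements are minimal. If `A` is the whole ideal boundary
then the slice contains no ray, as `C` would contain it too; so the slice is compact. The layers
over centers of `Z` are described by distances of minimal elements alone (`isCenter_iff`), which
gives the uniqueness of the central minimal element.

*Existence.* Suppose that members of the family tend to infinity. The projections of a base point
`o` to them lie in every horoball through `o` centered at a point of `A`, and hence so does a
limit ray `ξ`. If `A` contains a unit sphere, then `ξ` has Tits angle at most `π / 2` from all
points of the sphere, and exactly `π / 2`, because antipodes have angle `π`. The Tits angle is the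
asymptotic comparison angle (`titsAngle_eq`), so it is the angle in the cone at infinity, whose
points are the rays of constant speed from `o`. This cone has midpoints satisfying the Bruhat–Tits
inequality, and in such a space a Euclidean subspace and a ray perpendicular to it span a
Euclidean half-space (`exists_halfSpace`). Its unit vectors form a hemisphere bounded by the
sphere. So if the sphere bounds no hemisphere, the members of the family stay close to `o`; then
slices are bounded, and chains have non-empty intersections by compactness, so that Zorn's lemma
applies.
-/

/-! ### Geodesic segments and the Stewart inequality -/

/-- A Euclidean comparison triangle, together with the point at parameter `t` of one side. The
junk value of the quotient `u` at `a = 0` is harmless, as then `b = c`. -/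
theorem exists_comparison_triangle {a b c t : ℝ} (ha : 0 ≤ a) (hb : 0 ≤ b) (hc : 0 ≤ c)
    (ht : t ∈ Icc (0 : ℝ) 1) (h1 : a ≤ b + c) (h2 : b ≤ a + c) (h3 : c ≤ a + b) :
    ∃ x y z p : EuclideanSpace ℝ (Fin 2), dist x y = a ∧ dist x z = b ∧ dist y z = c ∧
      dist x p = t * a ∧ dist p y = (1 - t) * a ∧
      dist p z ^ 2 = (1 - t) * b ^ 2 + t * c ^ 2 - t * (1 - t) * a ^ 2 := by
  set u : ℝ := (a ^ 2 + b ^ 2 - c ^ 2) / (2 * a) with hu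
  have hau : 2 * a * u = a ^ 2 + b ^ 2 - c ^ 2 := by
    rcases eq_or_lt_of_le ha with h | h
    · have : b = c := by linarith
      subst this; simp [← h]
    · rw [hu]; field_simp
  have hub : u ^ 2 ≤ b ^ 2 := by
    rcases eq_or_lt_of_le ha with h | h
    · rw [hu, ← h]; simp; positivity
    · have : (2 * a * u) ^ 2 ≤ (2 * a * b) ^ 2 := by
        rw [hau]
        apply sq_le_sq'
        · nlinarith
        · nlinarith
      have h4 : 0 < (2 * a) ^ 2 := by positivity
      rw [mul_pow, mul_pow (2 * a) b] at this
      exact le_of_mul_le_mul_left this h4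
  set v : ℝ := √(b ^ 2 - u ^ 2) with hv
  have hv2 : v ^ 2 = b ^ 2 - u ^ 2 := Real.sq_sqrt (by linarith)
  have key : ∀ x₁ x₂ y₁ y₂ : ℝ,
      dist (!₂[x₁, x₂] : EuclideanSpace ℝ (Fin 2)) !₂[y₁, y₂]
        = √((x₁ - y₁) ^ 2 + (x₂ - y₂) ^ 2) := by
    intro x₁ x₂ y₁ y₂
    rw [EuclideanSpace.dist_eq]; simp [Fin.sum_univ_two, Real.dist_eq, sq_abs]
  refine ⟨!₂[0, 0], !₂[a, 0], !₂[u, v], !₂[t * a, 0], ?_, ?_, ?_, ?_, ?_, ?_⟩ <;> rw [key]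
  · rw [show (0 - a) ^ 2 + (0 - 0 : ℝ) ^ 2 = a ^ 2 by ring, Real.sqrt_sq ha]
  · rw [show (0 - u) ^ 2 + (0 - v) ^ 2 = b ^ 2 by linear_combination hv2, Real.sqrt_sq hb]
  · rw [show (a - u) ^ 2 + (0 - v) ^ 2 = c ^ 2 by linear_combination hv2 - hau, Real.sqrt_sq hc]
  · rw [show (0 - t * a) ^ 2 + (0 - 0 : ℝ) ^ 2 = (t * a) ^ 2 by ring,
      Real.sqrt_sq (mul_nonneg ht.1 ha)]
  · rw [show (t * a - a) ^ 2 + (0 - 0 : ℝ) ^ 2 = ((1 - t) * a) ^ 2 by ring,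
      Real.sqrt_sq (mul_nonneg (by linarith [ht.2]) ha)]
  · rw [Real.sq_sqrt (by positivity)]
    linear_combination hv2 - t * hau

namespace IsHadamard

variable {Y : Type u} [MetricSpace Y]

/-- The Stewart inequality: the distance from `z` to the point at parameter `t` of a segment is at
most the corresponding distance in a Euclidean comparison triangle. -/
theorem stewart (hY : IsHadamard Y) {x y p : Y} {t : ℝ} (ht : t ∈ Icc (0 : ℝ) 1)
    (h1 : dist x p = t * dist x y) (h2 : dist p y = (1 - t) * dist x y) (z : Y) :
    dist z p ^ 2 ≤ (1 - t) * dist z x ^ 2 + t * dist z y ^ 2 - t * (1 - t) * dist x y ^ 2 := by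
  obtain ⟨x', y', z', p', e1, e2, e3, e4, e5, e6⟩ := exists_comparison_triangle
    (a := dist x y) (b := dist x z) (c := dist y z) dist_nonneg dist_nonneg dist_nonneg ht
    (by rw [dist_comm y z]; exact dist_triangle _ _ _) (dist_triangle _ _ _)
    (by rw [dist_comm x y]; exact dist_triangle _ _ _)
  have := hY.comparison x y z p z (by rw [h1, h2]; ring) (by simp) x' y' z' p' z' e1 e3 e2
    (by rw [e4, h1]) (by rw [e5, h2]) e2 (by simp)
  rw [dist_comm z p, dist_comm z x, dist_comm z y, ← e6]
  gcongr

/-- The point at parameter `t ∈ [0, 1]` of the geodesic segment from `x` to `y`. -/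
noncomputable def seg (hY : IsHadamard Y) (x y : Y) (t : ℝ) : Y :=
  (hY.geodesic x y).choose (t * dist x y)

theorem dist_seg_seg (hY : IsHadamard Y) (x y : Y) {s t : ℝ} (hs : s ∈ Icc (0 : ℝ) 1)
    (ht : t ∈ Icc (0 : ℝ) 1) :
    dist (hY.seg x y s) (hY.seg x y t) = |s - t| * dist x y := by
  have h := (hY.geodesic x y).choose_spec.2.2 (s * dist x y)
    ⟨mul_nonneg hs.1 dist_nonneg, mul_le_of_le_one_left dist_nonneg hs.2⟩ (t * dist x y)
    ⟨mul_nonneg ht.1 dist_nonneg, mul_le_of_le_one_left dist_nonneg ht.2⟩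
  rw [seg, seg, h, ← sub_mul, abs_mul, abs_of_nonneg (dist_nonneg (x := x) (y := y))]

@[simp] theorem seg_zero (hY : IsHadamard Y) (x y : Y) : hY.seg x y 0 = x := by
  rw [seg, zero_mul]; exact (hY.geodesic x y).choose_spec.1

@[simp] theorem seg_one (hY : IsHadamard Y) (x y : Y) : hY.seg x y 1 = y := by
  rw [seg, one_mul]; exact (hY.geodesic x y).choose_spec.2.1

theorem dist_left_seg (hY : IsHadamard Y) (x y : Y) {t : ℝ} (ht : t ∈ Icc (0 : ℝ) 1) :
    dist x (hY.seg x y t) = t * dist x y := by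
  have := hY.dist_seg_seg x y (s := 0) (by simp) ht
  rwa [seg_zero, zero_sub, abs_neg, abs_of_nonneg ht.1] at this

theorem dist_seg_right (hY : IsHadamard Y) (x y : Y) {t : ℝ} (ht : t ∈ Icc (0 : ℝ) 1) :
    dist (hY.seg x y t) y = (1 - t) * dist x y := by
  have := hY.dist_seg_seg x y (t := 1) ht (by simp)
  rwa [seg_one, abs_sub_comm, abs_of_nonneg (by linarith [ht.2])] at this

theorem dist_seg_sq_le (hY : IsHadamard Y) (x y z : Y) {t : ℝ} (ht : t ∈ Icc (0 : ℝ) 1) :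
    dist z (hY.seg x y t) ^ 2 ≤
      (1 - t) * dist z x ^ 2 + t * dist z y ^ 2 - t * (1 - t) * dist x y ^ 2 :=
  hY.stewart ht (hY.dist_left_seg x y ht) (hY.dist_seg_right x y ht) z

/-- Geodesic segments are unique. -/
theorem eq_seg (hY : IsHadamard Y) {x y p : Y} {t : ℝ} (ht : t ∈ Icc (0 : ℝ) 1)
    (h1 : dist x p = t * dist x y) (h2 : dist p y = (1 - t) * dist x y) :
    p = hY.seg x y t := by
  have h := hY.dist_seg_sq_le x y p ht
  rw [dist_comm p x, h1, h2] at h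
  have : dist p (hY.seg x y t) ^ 2 ≤ 0 := by linarith
  exact dist_eq_zero.1 (pow_eq_zero_iff two_ne_zero |>.1 (le_antisymm this (sq_nonneg _)))

theorem seg_symm (hY : IsHadamard Y) (x y : Y) {t : ℝ} (ht : t ∈ Icc (0 : ℝ) 1) :
    hY.seg y x (1 - t) = hY.seg x y t := by
  have ht' : 1 - t ∈ Icc (0 : ℝ) 1 := ⟨by linarith [ht.2], by linarith [ht.1]⟩
  apply hY.eq_seg ht
  · rw [dist_comm, hY.dist_seg_right y x ht', dist_comm y x]; ring
  · rw [dist_comm, hY.dist_left_seg y x ht', dist_comm y x]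

/-- A point between `x` and `y` lies on the segment. -/
theorem exists_eq_seg (hY : IsHadamard Y) {x y p : Y} (h : dist x p + dist p y = dist x y) :
    ∃ t ∈ Icc (0 : ℝ) 1, p = hY.seg x y t := by
  rcases eq_or_lt_of_le (dist_nonneg (x := x) (y := y)) with h0 | h0
  · refine ⟨0, by simp, ?_⟩
    have h1 : dist x p = 0 := by
      linarith [dist_nonneg (x := x) (y := p), dist_nonneg (x := p) (y := y)]
    rw [seg_zero, dist_eq_zero.1 h1]
  · have ht : dist x p / dist x y ∈ Icc (0 : ℝ) 1 :=
      ⟨by positivity, by rw [div_le_one h0]; linarith [dist_nonneg (x := p) (y := y)]⟩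
    refine ⟨_, ht, hY.eq_seg ht (by field_simp) ?_⟩
    field_simp; linarith

theorem seg_between (hY : IsHadamard Y) (x y : Y) {t : ℝ} (ht : t ∈ Icc (0 : ℝ) 1) :
    dist x (hY.seg x y t) + dist (hY.seg x y t) y = dist x y := by
  rw [hY.dist_left_seg x y ht, hY.dist_seg_right x y ht]; ring

theorem seg_mem (hY : IsHadamard Y) {C : Set Y} (hC : GeodConvex C) {x y : Y} (hx : x ∈ C)
    (hy : y ∈ C) {t : ℝ} (ht : t ∈ Icc (0 : ℝ) 1) : hY.seg x y t ∈ C :=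
  hC x hx y hy _ (hY.seg_between x y ht)

theorem geodConvex_of_seg (hY : IsHadamard Y) {C : Set Y}
    (h : ∀ x ∈ C, ∀ y ∈ C, ∀ t ∈ Icc (0 : ℝ) 1, hY.seg x y t ∈ C) : GeodConvex C := by
  intro x hx y hy p hp
  obtain ⟨t, ht, rfl⟩ := hY.exists_eq_seg hp
  exact h x hx y hy t ht

/-- Triangles are thin. -/
theorem dist_seg_left_le (hY : IsHadamard Y) (x y z : Y) {t : ℝ} (ht : t ∈ Icc (0 : ℝ) 1) :
    dist (hY.seg x y t) (hY.seg x z t) ≤ t * dist y z := by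
  have h1 := hY.dist_seg_sq_le x z (hY.seg x y t) ht
  have h2 := hY.dist_seg_sq_le x y z ht
  rw [dist_comm _ x, hY.dist_left_seg x y ht, dist_comm _ z] at h1
  rw [dist_comm z x, dist_comm z y] at h2
  have h3 := mul_le_mul_of_nonneg_left h2 ht.1
  refine le_of_sq_le_sq ?_ (mul_nonneg ht.1 dist_nonneg)
  nlinarith

theorem dist_seg_seg_le (hY : IsHadamard Y) (x y x' y' : Y) {t : ℝ} (ht : t ∈ Icc (0 : ℝ) 1) :
    dist (hY.seg x y t) (hY.seg x' y' t) ≤ (1 - t) * dist x x' + t * dist y y' := by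
  have ht' : 1 - t ∈ Icc (0 : ℝ) 1 := ⟨by linarith [ht.2], by linarith [ht.1]⟩
  have h1 := hY.dist_seg_left_le x y y' ht
  have h2 := hY.dist_seg_left_le y' x x' ht'
  rw [hY.seg_symm x y' ht, hY.seg_symm x' y' ht] at h2
  linarith [dist_triangle (hY.seg x y t) (hY.seg x y' t) (hY.seg x' y' t)]

/-- The distance from a point is convex along a segment. -/
theorem dist_seg_le (hY : IsHadamard Y) (x y z : Y) {t : ℝ} (ht : t ∈ Icc (0 : ℝ) 1) :
    dist (hY.seg x y t) z ≤ (1 - t) * dist x z + t * dist y z := by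
  have h := hY.dist_seg_seg_le x y z z ht
  have hz : hY.seg z z t = z := (hY.eq_seg ht (by simp) (by simp)).symm
  rwa [hz] at h

/-- The quadrilateral inequality. -/
theorem quadrilateral (hY : IsHadamard Y) (a b c d : Y) :
    dist a c ^ 2 + dist b d ^ 2 ≤ dist a b ^ 2 + dist b c ^ 2 + dist c d ^ 2 + dist d a ^ 2 := by
  have ht : (1 / 2 : ℝ) ∈ Icc (0 : ℝ) 1 := by norm_num
  have h1 := hY.dist_seg_sq_le a c b ht
  have h2 := hY.dist_seg_sq_le a c d ht
  have h3 := dist_triangle_right b d (hY.seg a c (1 / 2))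
  have h4 : dist b d ^ 2 ≤ (dist b (hY.seg a c (1 / 2)) + dist d (hY.seg a c (1 / 2))) ^ 2 := by
    gcongr
  rw [dist_comm b a] at h1
  rw [dist_comm d c] at h2
  nlinarith [sq_nonneg (dist b (hY.seg a c (1 / 2)) - dist d (hY.seg a c (1 / 2)))]

/-- An isometric embedding maps segments to segments. -/
theorem map_seg (hY : IsHadamard Y) {h : Y → Y} {x y : Y} {t : ℝ} (ht : t ∈ Icc (0 : ℝ) 1)
    (h0 : dist (h x) (h y) = dist x y)
    (h1 : dist (h x) (h (hY.seg x y t)) = dist x (hY.seg x y t))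
    (h2 : dist (h (hY.seg x y t)) (h y) = dist (hY.seg x y t) y) :
    h (hY.seg x y t) = hY.seg (h x) (h y) t := by
  apply hY.eq_seg ht
  · rw [h1, hY.dist_left_seg x y ht, h0]
  · rw [h2, hY.dist_seg_right x y ht, h0]

/-! ### Properness -/

theorem exists_dist_le_of_le_add (hY : IsHadamard Y) {o x : Y} {r e : ℝ} (hr : 0 ≤ r)
    (he : 0 ≤ e) (h : dist x o ≤ r + e) : ∃ y, dist y o ≤ r ∧ dist x y ≤ e := by
  rcases le_or_gt (dist x o) r with h' | h'
  · exact ⟨x, h', by simpa⟩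
  · have h0 : 0 < dist x o := lt_of_le_of_lt hr h'
    have ht : r / dist x o ∈ Icc (0 : ℝ) 1 := ⟨by positivity, by rw [div_le_one h0]; exact h'.le⟩
    refine ⟨hY.seg o x (r / dist x o), ?_, ?_⟩
    · rw [dist_comm, hY.dist_left_seg o x ht, dist_comm o x]
      exact (div_mul_cancel₀ _ h0.ne').le
    · rw [dist_comm, hY.dist_seg_right o x ht, dist_comm o x, sub_mul,
        div_mul_cancel₀ _ h0.ne']
      linarith

/-- The Hopf–Rinow theorem: the radii of compact balls around a point form an interval that is
closed by completeness and open by local compactness. -/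
theorem properSpace [LocallyCompactSpace Y] (hY : IsHadamard Y) : ProperSpace Y := by
  have := hY.complete
  obtain ⟨o⟩ := hY.nonempty
  suffices H : ∀ r : ℝ, IsCompact (Metric.closedBall o r) by
    refine ProperSpace.of_isCompact_closedBall_of_le 0 fun x r _ => ?_
    exact (H (r + dist x o)).of_isClosed_subset Metric.isClosed_closedBall
      (Metric.closedBall_subset_closedBall' le_rfl)
  by_contra! hne
  obtain ⟨r₀, hr₀⟩ := hne
  set S : Set ℝ := {r | IsCompact (Metric.closedBall o r)} with hS
  have mono : ∀ r ∈ S, ∀ s ≤ r, s ∈ S := fun r hr s hs =>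
    hr.of_isClosed_subset Metric.isClosed_closedBall (Metric.closedBall_subset_closedBall hs)
  have hbdd : BddAbove S := ⟨r₀, fun r hr => le_of_not_ge fun h => hr₀ (mono r hr _ h)⟩
  have h0 : (0 : ℝ) ∈ S := by simp [hS]
  set R := sSup S
  have hR0 : 0 ≤ R := le_csSup hbdd h0
  have below : ∀ r < R, r ∈ S := fun r hr => by
    obtain ⟨s, hs, hrs⟩ := exists_lt_of_lt_csSup ⟨0, h0⟩ hr
    exact mono s hs r hrs.le
  have hRS : R ∈ S := by
    refine TotallyBounded.isCompact_of_isClosed ?_ Metric.isClosed_closedBall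
    rw [Metric.totallyBounded_iff]
    intro ε hε
    rcases eq_or_lt_of_le hR0 with hR' | hR'
    · exact Metric.totallyBounded_iff.1 (hR' ▸ h0 : IsCompact _).totallyBounded ε hε
    · set e := min R (ε / 2) / 2 with he
      have he0 : 0 < e := by positivity
      have heR : e < R := by have := min_le_left R (ε / 2); linarith
      have heε : e < ε / 2 := by have := min_le_right R (ε / 2); linarith
      obtain ⟨t, ht, hsub⟩ := Metric.totallyBounded_iff.1
        (below (R - e) (by linarith) : IsCompact _).totallyBounded (ε / 2) (by linarith)
      refine ⟨t, ht, fun x hx => ?_⟩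
      obtain ⟨y, hy, hxy⟩ := hY.exists_dist_le_of_le_add (r := R - e) (e := e) (x := x) (o := o)
        (by linarith) he0.le (by simpa using hx)
      obtain ⟨z, hz, hyz⟩ := mem_iUnion₂.1 (hsub (Metric.mem_closedBall.2 hy))
      refine mem_iUnion₂.2 ⟨z, hz, ?_⟩
      rw [Metric.mem_ball] at hyz ⊢
      linarith [dist_triangle x y z]
  obtain ⟨K, hK, hKR⟩ := exists_compact_superset (show IsCompact (Metric.closedBall o R) from hRS)
  obtain ⟨δ, hδ, hsub⟩ := IsCompact.exists_cthickening_subset_open hRS isOpen_interior hKR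
  have : R + δ ∈ S := by
    refine hK.of_isClosed_subset Metric.isClosed_closedBall fun x hx => ?_
    refine interior_subset (hsub ?_)
    obtain ⟨y, hy, hxy⟩ := hY.exists_dist_le_of_le_add (r := R) (e := δ) (x := x) (o := o)
        hR0 hδ.le (by simpa using hx)
    exact Metric.mem_cthickening_of_dist_le x y δ _ (Metric.mem_closedBall.2 hy) hxy
  linarith [le_csSup hbdd this]

end IsHadamard

/-! ### Nearest point projections -/

open Classical in
/-- A point of `C` nearest to `x`; the value is `x` if there is none. -/
noncomputable def nearestPt {Y : Type u} [MetricSpace Y] (C : Set Y) (x : Y) : Y :=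
  if h : ∃ p ∈ C, Metric.infDist x C = dist x p then h.choose else x

section Proj

variable {Y : Type u} [MetricSpace Y]

theorem nearestPt_spec [ProperSpace Y] {C : Set Y} (hne : C.Nonempty) (hcl : IsClosed C) (x : Y) :
    nearestPt C x ∈ C ∧ Metric.infDist x C = dist x (nearestPt C x) := by
  have h : ∃ p ∈ C, Metric.infDist x C = dist x p := hcl.exists_infDist_eq_dist hne x
  rw [nearestPt, dif_pos h]
  exact h.choose_spec

theorem le_infDist {C : Set Y} (hne : C.Nonempty) {x : Y} {r : ℝ} (h : ∀ y ∈ C, r ≤ dist x y) :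
    r ≤ Metric.infDist x C :=
  (Metric.le_infDist hne).2 fun {y} hy => h y hy

namespace IsHadamard

/-- The Pythagorean inequality for a nearest point `p` of a convex set. -/
theorem pythagoras_le (hY : IsHadamard Y) {C : Set Y} (hC : GeodConvex C) {x p y : Y}
    (hp : p ∈ C) (hxp : Metric.infDist x C = dist x p) (hy : y ∈ C) :
    dist x p ^ 2 + dist p y ^ 2 ≤ dist x y ^ 2 := by
  have key : ∀ t ∈ Ioc (0 : ℝ) 1, dist x p ^ 2 + (1 - t) * dist p y ^ 2 ≤ dist x y ^ 2 := by
    intro t ht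
    have ht' : t ∈ Icc (0 : ℝ) 1 := ⟨ht.1.le, ht.2⟩
    have h1 := hY.dist_seg_sq_le p y x ht'
    have h2 : dist x p ≤ dist x (hY.seg p y t) := by
      rw [← hxp]; exact Metric.infDist_le_dist_of_mem (hY.seg_mem hC hp hy ht')
    have h3 : dist x p ^ 2 ≤ dist x (hY.seg p y t) ^ 2 := by gcongr
    have h4 : t * (dist x p ^ 2 + (1 - t) * dist p y ^ 2) ≤ t * dist x y ^ 2 := by linarith
    exact le_of_mul_le_mul_left h4 ht.1
  have hlim : Tendsto (fun t : ℝ => dist x p ^ 2 + (1 - t) * dist p y ^ 2) (𝓝[>] 0)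
      (𝓝 (dist x p ^ 2 + (1 - 0) * dist p y ^ 2)) :=
    ((by fun_prop : Continuous fun t : ℝ =>
      dist x p ^ 2 + (1 - t) * dist p y ^ 2).tendsto 0).mono_left nhdsWithin_le_nhds
  have := le_of_tendsto hlim (by
    filter_upwards [Ioc_mem_nhdsGT (zero_lt_one (α := ℝ))] with t ht using key t ht)
  simpa using this

theorem eq_nearestPt [ProperSpace Y] (hY : IsHadamard Y) {C : Set Y} (hcl : IsClosed C)
    (hC : GeodConvex C) {x p : Y} (hp : p ∈ C) (hxp : dist x p ≤ Metric.infDist x C) :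
    nearestPt C x = p := by
  obtain ⟨h1, h2⟩ := nearestPt_spec ⟨p, hp⟩ hcl x
  have h3 := hY.pythagoras_le hC h1 h2 hp
  rw [h2] at hxp
  have : dist x p ^ 2 ≤ dist x (nearestPt C x) ^ 2 := by gcongr
  have h4 : dist (nearestPt C x) p ^ 2 ≤ 0 := by linarith
  exact dist_eq_zero.1 (pow_eq_zero_iff two_ne_zero |>.1 (le_antisymm h4 (sq_nonneg _)))

theorem nearestPt_of_mem [ProperSpace Y] (hY : IsHadamard Y) {C : Set Y} (hcl : IsClosed C)
    (hC : GeodConvex C) {x : Y} (hx : x ∈ C) : nearestPt C x = x :=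
  hY.eq_nearestPt hcl hC hx (by simp [Metric.infDist_nonneg])

theorem dist_nearestPt_le [ProperSpace Y] (hY : IsHadamard Y) {C : Set Y} (hne : C.Nonempty)
    (hcl : IsClosed C) (hC : GeodConvex C) (x y : Y) :
    dist (nearestPt C x) (nearestPt C y) ≤ dist x y := by
  obtain ⟨h1, h2⟩ := nearestPt_spec hne hcl x
  obtain ⟨h3, h4⟩ := nearestPt_spec hne hcl y
  set p := nearestPt C x
  set q := nearestPt C y
  have e1 := hY.pythagoras_le hC h1 h2 h3
  have e2 := hY.pythagoras_le hC h3 h4 h1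
  have e3 := hY.quadrilateral x p q y
  rw [dist_comm q p] at e2
  rw [dist_comm p y, dist_comm q y, dist_comm y x] at e3
  refine le_of_sq_le_sq ?_ dist_nonneg
  linarith

/-- The distance from a convex set is a convex function. -/
theorem infDist_seg_le [ProperSpace Y] (hY : IsHadamard Y) {C : Set Y} (hne : C.Nonempty)
    (hcl : IsClosed C) (hC : GeodConvex C) (x y : Y) {t : ℝ} (ht : t ∈ Icc (0 : ℝ) 1) :
    Metric.infDist (hY.seg x y t) C ≤ (1 - t) * Metric.infDist x C + t * Metric.infDist y C := by
  obtain ⟨h1, h2⟩ := nearestPt_spec hne hcl x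
  obtain ⟨h3, h4⟩ := nearestPt_spec hne hcl y
  rw [h2, h4]
  exact (Metric.infDist_le_dist_of_mem (hY.seg_mem hC h1 h3 ht)).trans
    (hY.dist_seg_seg_le _ _ _ _ ht)

theorem geodConvex_infDist_le [ProperSpace Y] (hY : IsHadamard Y) {C : Set Y} (hne : C.Nonempty)
    (hcl : IsClosed C) (hC : GeodConvex C) (r : ℝ) : GeodConvex {x | Metric.infDist x C ≤ r} := by
  refine hY.geodConvex_of_seg fun x hx y hy t ht => (hY.infDist_seg_le hne hcl hC x y ht).trans ?_
  rw [mem_ofPred_eq] at hx hy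
  nlinarith [ht.1, ht.2]

end IsHadamard

end Proj

theorem GeodConvex.inter {Y : Type u} [MetricSpace Y] {C D : Set Y} (hC : GeodConvex C)
    (hD : GeodConvex D) : GeodConvex (C ∩ D) :=
  fun x hx y hy p hp => ⟨hC x hx.1 y hy.1 p hp, hD x hx.2 y hy.2 p hp⟩

theorem GeodConvex.iInter {Y : Type u} [MetricSpace Y] {ι : Sort*} {C : ι → Set Y}
    (hC : ∀ i, GeodConvex (C i)) : GeodConvex (⋂ i, C i) :=
  fun x hx y hy p hp => mem_iInter.2 fun i =>
    hC i x (mem_iInter.1 hx i) y (mem_iInter.1 hy i) p hp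

/-! ### Rays -/

section Rays

variable {Y : Type u} [MetricSpace Y]

namespace GeodesicRay

theorem dist_eq (ρ : GeodesicRay Y) (s t : ℝ≥0) : dist (ρ.1 s) (ρ.1 t) = |(s : ℝ) - t| := by
  rw [ρ.2.dist_eq, NNReal.dist_eq]

theorem dist_zero (ρ : GeodesicRay Y) (t : ℝ≥0) : dist (ρ.1 0) (ρ.1 t) = t := by
  rw [ρ.dist_eq]; simp

theorem eq_seg (hY : IsHadamard Y) (ρ : GeodesicRay Y) {s t : ℝ≥0} (hst : s ≤ t) (ht : 0 < t) :
    ρ.1 s = hY.seg (ρ.1 0) (ρ.1 t) (s / t) := by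
  have ht' : (0 : ℝ) < t := ht
  have hst' : (s : ℝ) ≤ t := hst
  have h01 : (s / t : ℝ) ∈ Icc (0 : ℝ) 1 := ⟨by positivity, by rw [div_le_one ht']; exact hst'⟩
  apply hY.eq_seg h01
  · rw [dist_zero, dist_zero]; field_simp
  · rw [dist_eq, dist_zero, abs_sub_comm, abs_of_nonneg (by linarith)]; field_simp

theorem endpoint_eq_iff {ρ σ : GeodesicRay Y} : ρ.endpoint = σ.endpoint ↔ Asymptotic ρ σ :=
  ⟨fun h => Quotient.exact h, fun h => Quotient.sound h⟩

/-- A function that is convex and bounded above along a ray is bounded by its initial value. -/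
theorem le_zero_of_convex_of_bounded (hY : IsHadamard Y) (ρ : GeodesicRay Y) {f : Y → ℝ} {M : ℝ}
    (hconv : ∀ t : ℝ≥0, ∀ τ ∈ Icc (0 : ℝ) 1,
      f (hY.seg (ρ.1 0) (ρ.1 t) τ) ≤ (1 - τ) * f (ρ.1 0) + τ * f (ρ.1 t))
    (hM : ∀ t, f (ρ.1 t) ≤ M) (s : ℝ≥0) : f (ρ.1 s) ≤ f (ρ.1 0) := by
  have key : ∀ t : ℝ≥0, s ≤ t → 0 < t →
      f (ρ.1 s) ≤ f (ρ.1 0) + (s / t : ℝ) * (M - f (ρ.1 0)) := by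
    intro t hst ht
    have ht' : (0 : ℝ) < t := ht
    have hst' : (s : ℝ) ≤ t := hst
    have h01 : (s / t : ℝ) ∈ Icc (0 : ℝ) 1 := ⟨by positivity, by rw [div_le_one ht']; exact hst'⟩
    have h1 := hconv t _ h01
    rw [← eq_seg hY ρ hst ht] at h1
    have h2 := mul_le_mul_of_nonneg_left (hM t) h01.1
    linarith
  have hlim : Tendsto (fun t : ℝ≥0 => f (ρ.1 0) + (s / t : ℝ) * (M - f (ρ.1 0))) atTop
      (𝓝 (f (ρ.1 0) + 0 * (M - f (ρ.1 0)))) := by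
    refine tendsto_const_nhds.add (Tendsto.mul_const _ ?_)
    exact (NNReal.tendsto_coe_atTop.2 tendsto_id).const_div_atTop _
  have := ge_of_tendsto hlim (by
    filter_upwards [eventually_ge_atTop s, eventually_gt_atTop 0] with t h1 h2 using key t h1 h2)
  simpa using this

/-- The distance of asymptotic rays is at most the distance of their initial points. -/
theorem dist_le_of_asymptotic (hY : IsHadamard Y) {ρ σ : GeodesicRay Y} (h : Asymptotic ρ σ)
    (s : ℝ≥0) : dist (ρ.1 s) (σ.1 s) ≤ dist (ρ.1 0) (σ.1 0) := by
  obtain ⟨M, hM⟩ := h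
  have key : ∀ t : ℝ≥0, s ≤ t → 0 < t →
      dist (ρ.1 s) (σ.1 s) ≤ (1 - (s / t : ℝ)) * dist (ρ.1 0) (σ.1 0) + (s / t : ℝ) * M := by
    intro t hst ht
    have ht' : (0 : ℝ) < t := ht
    have hst' : (s : ℝ) ≤ t := hst
    have h01 : (s / t : ℝ) ∈ Icc (0 : ℝ) 1 := ⟨by positivity, by rw [div_le_one ht']; exact hst'⟩
    have h1 := hY.dist_seg_seg_le (ρ.1 0) (ρ.1 t) (σ.1 0) (σ.1 t) h01
    rw [← eq_seg hY ρ hst ht, ← eq_seg hY σ hst ht] at h1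
    have h2 := mul_le_mul_of_nonneg_left (hM t) h01.1
    linarith
  have h0 : Tendsto (fun t : ℝ≥0 => (s / t : ℝ)) atTop (𝓝 0) :=
    (NNReal.tendsto_coe_atTop.2 tendsto_id).const_div_atTop _
  have hlim := ((tendsto_const_nhds (x := (1 : ℝ))).sub h0).mul_const (dist (ρ.1 0) (σ.1 0))
    |>.add (h0.mul_const M)
  have := ge_of_tendsto hlim (by
    filter_upwards [eventually_ge_atTop s, eventually_gt_atTop 0] with t h1 h2 using key t h1 h2)
  simpa using this

theorem eq_of_asymptotic (hY : IsHadamard Y) {ρ σ : GeodesicRay Y} (h : Asymptotic ρ σ)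
    (h0 : ρ.1 0 = σ.1 0) (t : ℝ≥0) : ρ.1 t = σ.1 t := by
  have := dist_le_of_asymptotic hY h t
  rw [h0, dist_self] at this
  exact dist_le_zero.1 this

end GeodesicRay

namespace IsHadamard

/-- Segments from `x` to points tending to infinity subconverge to a ray. -/
theorem exists_limit_ray [ProperSpace Y] (hY : IsHadamard Y) (x : Y) (p : ℕ → Y)
    (hp : Tendsto (fun n => dist x (p n)) atTop atTop) :
    ∃ (ρ : GeodesicRay Y) (U : Filter ℕ), U.NeBot ∧ U ≤ atTop ∧ ρ.1 0 = x ∧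
      ∀ t : ℝ≥0, Tendsto (fun n => hY.seg x (p n) (t / dist x (p n))) U (𝓝 (ρ.1 t)) := by
  set U : Ultrafilter ℕ := hyperfilter ℕ
  have hUle : (U : Filter ℕ) ≤ atTop := Nat.hyperfilter_le_atTop
  have h01 : ∀ t : ℝ≥0, ∀ᶠ n in (U : Filter ℕ), 0 < dist x (p n) ∧
      (t / dist x (p n) : ℝ) ∈ Icc (0 : ℝ) 1 := by
    intro t
    filter_upwards [hUle (hp.eventually_ge_atTop (t : ℝ)), hUle (hp.eventually_gt_atTop 0)]
      with n h1 h2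
    exact ⟨h2, by positivity, by rw [div_le_one h2]; exact h1⟩
  have hex : ∀ t : ℝ≥0, ∃ y, Tendsto (fun n => hY.seg x (p n) (t / dist x (p n))) U (𝓝 y) := by
    intro t
    obtain ⟨y, -, hy⟩ := (isCompact_closedBall x (t : ℝ)).ultrafilter_le_nhds
      (U.map fun n => hY.seg x (p n) (t / dist x (p n))) (by
        rw [le_principal_iff]
        change ∀ᶠ n in (U : Filter ℕ), _
        filter_upwards [h01 t] with n hn
        rw [Metric.mem_closedBall, dist_comm, hY.dist_left_seg _ _ hn.2,
          div_mul_cancel₀ _ hn.1.ne'])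
    exact ⟨y, hy⟩
  choose ρ hρ using hex
  refine ⟨⟨ρ, Isometry.of_dist_eq fun s t => ?_⟩, U, inferInstance, hUle, ?_, hρ⟩
  · refine tendsto_nhds_unique ((hρ s).dist (hρ t)) (tendsto_const_nhds.congr' ?_)
    filter_upwards [h01 s, h01 t] with n hs ht
    rw [hY.dist_seg_seg _ _ hs.2 ht.2, ← sub_div, abs_div, abs_of_pos hs.1,
      div_mul_cancel₀ _ hs.1.ne', NNReal.dist_eq]
  · refine tendsto_nhds_unique (hρ 0) (tendsto_const_nhds.congr fun n => ?_)
    simp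

/-- An unbounded closed convex set contains a ray. -/
theorem exists_ray_of_unbounded [ProperSpace Y] (hY : IsHadamard Y) {S : Set Y} (hcl : IsClosed S)
    (hS : GeodConvex S) {x : Y} (hx : x ∈ S) (h : ∀ r : ℝ, ∃ y ∈ S, r < dist x y) :
    ∃ ρ : GeodesicRay Y, ρ.1 0 = x ∧ ∀ t, ρ.1 t ∈ S := by
  choose p hpS hp using fun n : ℕ => h n
  have hlim : Tendsto (fun n => dist x (p n)) atTop atTop :=
    tendsto_atTop_mono (fun n => (hp n).le) tendsto_natCast_atTop_atTop
  obtain ⟨ρ, U, hU, hUle, h0, hρ⟩ := hY.exists_limit_ray x p hlim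
  refine ⟨ρ, h0, fun t => hcl.mem_of_tendsto (hρ t) ?_⟩
  filter_upwards [hUle (hlim.eventually_ge_atTop (t : ℝ)), hUle (hlim.eventually_gt_atTop 0)]
    with n h1 h2
  exact hY.seg_mem hS hx (hpS n) ⟨by positivity, by rw [div_le_one h2]; exact h1⟩

/-- From each point of a closed convex set issues a ray of the set asymptotic to a given one. -/
theorem exists_asymptotic_mem [ProperSpace Y] (hY : IsHadamard Y) {S : Set Y} (hcl : IsClosed S)
    (hS : GeodConvex S) {x : Y} (hx : x ∈ S) (σ : GeodesicRay Y) (hσ : ∀ t, σ.1 t ∈ S) :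
    ∃ ρ : GeodesicRay Y, ρ.1 0 = x ∧ Asymptotic ρ σ ∧ ∀ t, ρ.1 t ∈ S := by
  set D := dist x (σ.1 0) with hD
  have hnear : ∀ n : ℕ, |dist x (σ.1 n) - n| ≤ D := by
    intro n
    have h1 := σ.dist_zero n
    have h2 := abs_dist_sub_le x (σ.1 0) (σ.1 n)
    rw [h1] at h2
    simpa using h2
  have hlim : Tendsto (fun n : ℕ => dist x (σ.1 n)) atTop atTop := by
    refine tendsto_atTop_mono (f := fun n : ℕ => (n : ℝ) - D) (fun n => ?_)
      (tendsto_atTop_add_const_right _ _ tendsto_natCast_atTop_atTop)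
    linarith [(abs_le.1 (hnear n)).1]
  obtain ⟨ρ, U, hU, hUle, h0, hρ⟩ := hY.exists_limit_ray x (fun n => σ.1 n) hlim
  refine ⟨ρ, h0, ⟨2 * D, fun t => ?_⟩, fun t => hcl.mem_of_tendsto (hρ t) ?_⟩
  · refine le_of_tendsto ((hρ t).dist tendsto_const_nhds) ?_
    filter_upwards [hUle (hlim.eventually_ge_atTop (t : ℝ)), hUle (hlim.eventually_gt_atTop 0),
      hUle (tendsto_natCast_atTop_atTop.eventually_ge_atTop (t : ℝ)),
      hUle (eventually_gt_atTop 0)] with n h1 h2 h3 h4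
    have h4' : (0 : ℝ) < n := by exact_mod_cast h4
    have e1 : (t / dist x (σ.1 n) : ℝ) ∈ Icc (0 : ℝ) 1 :=
      ⟨by positivity, by rw [div_le_one h2]; exact h1⟩
    have e2 : (t / n : ℝ) ∈ Icc (0 : ℝ) 1 := ⟨by positivity, by rw [div_le_one h4']; exact h3⟩
    have e3 : dist (hY.seg x (σ.1 n) (t / n)) (σ.1 t) ≤ D := by
      have h5 := hY.dist_seg_seg_le x (σ.1 n) (σ.1 0) (σ.1 n) e2
      have h6 := GeodesicRay.eq_seg hY σ (s := t) (t := n) (by exact_mod_cast h3)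
        (by exact_mod_cast h4)
      rw [NNReal.coe_natCast] at h6
      rw [← h6, dist_self, mul_zero, add_zero, ← hD] at h5
      nlinarith [e2.1, dist_nonneg (x := x) (y := σ.1 0)]
    have e4 : dist (hY.seg x (σ.1 n) (t / dist x (σ.1 n))) (hY.seg x (σ.1 n) (t / n)) ≤ D := by
      rw [hY.dist_seg_seg _ _ e1 e2]
      have : |t / dist x (σ.1 n) - t / n| * dist x (σ.1 n)
          = (t / n : ℝ) * |dist x (σ.1 n) - n| := by
        rw [← abs_of_pos h2, ← abs_mul, abs_of_pos h2, ← abs_of_nonneg e2.1, ← abs_mul,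
          abs_of_nonneg e2.1, ← abs_neg]
        congr 1
        field_simp
        ring
      rw [this]
      have := hnear n
      nlinarith [e2.1, e2.2, abs_nonneg (dist x (σ.1 n) - n)]
    linarith [dist_triangle (hY.seg x (σ.1 n) (t / dist x (σ.1 n))) (hY.seg x (σ.1 n) (t / n))
      (σ.1 t)]
  · filter_upwards [hUle (hlim.eventually_ge_atTop (t : ℝ)), hUle (hlim.eventually_gt_atTop 0)]
      with n h1 h2
    exact hY.seg_mem hS hx (hσ n) ⟨by positivity, by rw [div_le_one h2]; exact h1⟩

theorem exists_asymptotic [ProperSpace Y] (hY : IsHadamard Y) (x : Y) (σ : GeodesicRay Y) :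
    ∃ ρ : GeodesicRay Y, ρ.1 0 = x ∧ Asymptotic ρ σ := by
  obtain ⟨ρ, h0, h1, -⟩ := hY.exists_asymptotic_mem isClosed_univ (fun _ _ _ _ _ _ => mem_univ _)
    (mem_univ x) σ fun _ => mem_univ _
  exact ⟨ρ, h0, h1⟩

end IsHadamard

end Rays

/-! ### Minimal elements of the family -/

section Minimal

variable {Y : Type u} [MetricSpace Y] {A : Set (IdealBoundary Y)}

/-- Intersecting with a closed convex set preserves the family if no ray with endpoint in `A`
leaves that set. -/
theorem IsHadamard.inter_mem_convexFamily [ProperSpace Y] (hY : IsHadamard Y) {C D : Set Y}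
    (hC : C ∈ convexFamily A) (hDcl : IsClosed (C ∩ D)) (hD : GeodConvex (C ∩ D))
    (hne : (C ∩ D).Nonempty)
    (hray : ∀ ρ : GeodesicRay Y, (∀ t, ρ.1 t ∈ C) → ρ.endpoint ∈ A → ρ.1 0 ∈ D →
      ∀ t, ρ.1 t ∈ D) :
    C ∩ D ∈ convexFamily A := by
  refine ⟨hne, hDcl, hD, fun ξ hξ => ?_⟩
  obtain ⟨σ, hσC, rfl⟩ := hC.2.2.2 hξ
  obtain ⟨x, hx⟩ := hne
  obtain ⟨ρ, h0, has, hρ⟩ := hY.exists_asymptotic_mem hC.2.1 hC.2.2.1 hx.1 σ hσC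
  have he : ρ.endpoint = σ.endpoint := GeodesicRay.endpoint_eq_iff.2 has
  exact ⟨ρ, fun t => ⟨hρ t, hray ρ hρ (he ▸ hξ) (h0 ▸ hx.2) t⟩, he⟩

theorem IsMinimalFor.eq_of_subset {K C : Set Y} (hK : IsMinimalFor A K) (hC : C ∈ convexFamily A)
    (h : C ⊆ K) : C = K :=
  h.antisymm (hK.2 hC h)

/-- Along a ray with endpoint in `A` the distance from a member of the family does not exceed its
initial value. -/
theorem IsHadamard.infDist_ray_le [ProperSpace Y] (hY : IsHadamard Y) {C : Set Y}
    (hC : C ∈ convexFamily A) (ρ : GeodesicRay Y) (hρ : ρ.endpoint ∈ A) (t : ℝ≥0) :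
    Metric.infDist (ρ.1 t) C ≤ Metric.infDist (ρ.1 0) C := by
  obtain ⟨σ, hσC, hσ⟩ := hC.2.2.2 hρ
  obtain ⟨M, hM⟩ := GeodesicRay.endpoint_eq_iff.1 hσ
  refine GeodesicRay.le_zero_of_convex_of_bounded hY ρ (f := fun y => Metric.infDist y C) (M := M)
    (fun t τ hτ => hY.infDist_seg_le hC.1 hC.2.1 hC.2.2.1 _ _ hτ) (fun s => ?_) t
  refine (Metric.infDist_le_dist_of_mem (hσC s)).trans ?_
  rw [dist_comm]; exact hM s

/-- The distance from a member of the family is constant on a minimal element. -/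
theorem IsMinimalFor.infDist_eq [ProperSpace Y] (hY : IsHadamard Y) {K C : Set Y}
    (hK : IsMinimalFor A K) (hC : C ∈ convexFamily A) {x y : Y} (hx : x ∈ K) (hy : y ∈ K) :
    Metric.infDist x C = Metric.infDist y C := by
  have key : ∀ x ∈ K, ∀ y ∈ K, Metric.infDist y C ≤ Metric.infDist x C := by
    intro x hx y hy
    have hmem : K ∩ {z | Metric.infDist z C ≤ Metric.infDist x C} ∈ convexFamily A := by
      refine hY.inter_mem_convexFamily hK.1
        (hK.1.2.1.inter (isClosed_le (Metric.continuous_infDist_pt C) continuous_const))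
        (hK.1.2.2.1.inter (hY.geodConvex_infDist_le hC.1 hC.2.1 hC.2.2.1 _))
        ⟨x, hx, le_refl (Metric.infDist x C)⟩ ?_
      exact fun ρ _ hρA h0 t => (hY.infDist_ray_le hC ρ hρA t).trans h0
    exact (hK.2 hmem inter_subset_left hy).2
  exact (key y hy x hx).antisymm (key x hx y hy)

/-- Two closed convex sets each of which has constant distance `D` from the other. -/
structure IsParallel (K L : Set Y) (D : ℝ) : Prop where
  nonempty_left : K.Nonempty
  nonempty_right : L.Nonempty
  closed_left : IsClosed K
  closed_right : IsClosed L
  convex_left : GeodConvex K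
  convex_right : GeodConvex L
  infDist_left : ∀ x ∈ K, Metric.infDist x L = D
  infDist_right : ∀ y ∈ L, Metric.infDist y K = D

theorem IsMinimalFor.exists_isParallel [ProperSpace Y] (hY : IsHadamard Y) {K L : Set Y}
    (hK : IsMinimalFor A K) (hL : IsMinimalFor A L) : ∃ D, IsParallel K L D := by
  obtain ⟨x, hx⟩ := hK.1.1
  obtain ⟨y, hy⟩ := hL.1.1
  have key : ∀ K L : Set Y, IsMinimalFor A K → IsMinimalFor A L → ∀ x ∈ K, ∀ y ∈ L,
      Metric.infDist y K ≤ Metric.infDist x L := by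
    intro K L hK hL x hx y hy
    obtain ⟨h1, h2⟩ := nearestPt_spec hL.1.1 hL.1.2.1 x
    rw [hL.infDist_eq hY hK.1 hy h1, h2, dist_comm]
    exact Metric.infDist_le_dist_of_mem hx
  refine ⟨Metric.infDist x L, hK.1.1, hL.1.1, hK.1.2.1, hL.1.2.1, hK.1.2.2.1, hL.1.2.2.1,
    fun z hz => hK.infDist_eq hY hL.1 hz hx, fun z hz => ?_⟩
  exact (key K L hK hL x hx z hz).antisymm (key L K hL hK z hz x hx)

namespace IsParallel

variable {K L : Set Y} {D : ℝ}

theorem symm (h : IsParallel K L D) : IsParallel L K D :=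
  ⟨h.2, h.1, h.4, h.3, h.6, h.5, h.8, h.7⟩

variable [ProperSpace Y]

theorem nearestPt_mem (h : IsParallel K L D) (x : Y) : nearestPt L x ∈ L :=
  (nearestPt_spec h.2 h.4 x).1

theorem dist_nearestPt (h : IsParallel K L D) {x : Y} (hx : x ∈ K) :
    dist x (nearestPt L x) = D := by
  rw [← (nearestPt_spec h.2 h.4 x).2, h.7 x hx]

theorem nearestPt_nearestPt (hY : IsHadamard Y) (h : IsParallel K L D) {x : Y} (hx : x ∈ K) :
    nearestPt K (nearestPt L x) = x := by
  refine hY.eq_nearestPt h.3 h.5 hx ?_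
  rw [h.8 _ (h.nearestPt_mem x), dist_comm, h.dist_nearestPt hx]

/-- Parallel sets bound a metric product `K × [0, D]`: the Pythagorean inequalities for the four
corners of a quadrilateral are equalities, by the quadrilateral inequality. -/
theorem dist_sq (hY : IsHadamard Y) (h : IsParallel K L D) {x y : Y} (hx : x ∈ K) (hy : y ∈ L) :
    dist x y ^ 2 = D ^ 2 + dist (nearestPt L x) y ^ 2 ∧
      dist (nearestPt L x) y = dist x (nearestPt K y) := by
  have hx' := h.nearestPt_mem x
  have hy' := h.symm.nearestPt_mem y
  have hxx := h.dist_nearestPt hx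
  have hyy := h.symm.dist_nearestPt hy
  set x' := nearestPt L x
  set y' := nearestPt K y
  have e1 := hY.pythagoras_le h.6 hx' (by rw [h.7 x hx, hxx]) hy
  have e2 := hY.pythagoras_le h.5 hy' (by rw [h.8 y hy, hyy]) hx
  have e3 := hY.pythagoras_le h.5 hx (x := x') (by rw [h.8 x' hx', dist_comm, hxx]) hy'
  have e4 := hY.pythagoras_le h.6 hy (x := y') (by rw [h.7 y' hy', dist_comm, hyy]) hx'
  have e5 := hY.quadrilateral x x' y y'
  rw [hxx] at e1
  rw [hyy, dist_comm y' x, dist_comm y x] at e2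
  rw [dist_comm x' x, hxx] at e3
  rw [dist_comm y' y, hyy, dist_comm y x', dist_comm y' x'] at e4
  rw [hxx, hyy, dist_comm y' x] at e5
  have e6 : dist x' y ^ 2 = dist x y' ^ 2 := by linarith
  refine ⟨by linarith, ?_⟩
  exact (pow_left_inj₀ dist_nonneg dist_nonneg two_ne_zero).1 e6

theorem dist_nearestPt_nearestPt (hY : IsHadamard Y) (h : IsParallel K L D) {x y : Y}
    (hx : x ∈ K) (hy : y ∈ K) : dist (nearestPt L x) (nearestPt L y) = dist x y := by
  have := (h.dist_sq hY hx (h.nearestPt_mem y)).2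
  rwa [h.nearestPt_nearestPt hY hy] at this

/-- Going around three pairwise parallel sets by nearest point projections preserves distances. -/
theorem dist_holonomy (hY : IsHadamard Y) {M : Set Y} {D' D'' : ℝ} (h : IsParallel K L D)
    (h' : IsParallel L M D') (h'' : IsParallel K M D'') {x y : Y} (hx : x ∈ K) (hy : y ∈ K) :
    dist (nearestPt K (nearestPt M (nearestPt L x))) (nearestPt K (nearestPt M (nearestPt L y)))
      = dist x y := by
  rw [h''.symm.dist_nearestPt_nearestPt hY (h'.nearestPt_mem _) (h'.nearestPt_mem _),
    h'.dist_nearestPt_nearestPt hY (h.nearestPt_mem _) (h.nearestPt_mem _),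
    h.dist_nearestPt_nearestPt hY hx hy]

end IsParallel

/-- If an isometric embedding of a convex set into itself displaces all points by `δ`, then its
iterates of order `2 ^ k` displace all points by `2 ^ k * δ`: compare the midpoints of the two
sides of the triangle `x, h x, h (h x)`. -/
theorem IsHadamard.dist_iterate_two_pow (hY : IsHadamard Y) {K : Set Y} (hK : GeodConvex K)
    (k : ℕ) :
    ∀ {h : Y → Y} {δ : ℝ}, MapsTo h K K → (∀ x ∈ K, ∀ y ∈ K, dist (h x) (h y) = dist x y) →
      (∀ x ∈ K, dist x (h x) = δ) → ∀ x ∈ K, dist x (h^[2 ^ k] x) = 2 ^ k * δ := by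
  induction k with
  | zero => intro h δ _ _ hδ x hx; simpa using hδ x hx
  | succ k ih =>
    intro h δ hm hi hδ x hx
    have h2 : ∀ x ∈ K, dist x (h^[2] x) = 2 * δ := by
      intro x hx
      have ht : (1 / 2 : ℝ) ∈ Icc (0 : ℝ) 1 := by norm_num
      have hmid := hY.seg_mem hK hx (hm hx) ht
      have e1 : h (hY.seg x (h x) (1 / 2)) = hY.seg (h x) (h (h x)) (1 / 2) :=
        hY.map_seg ht (hi _ hx _ (hm hx)) (hi _ hx _ hmid) (hi _ hmid _ (hm hx))
      have e2 := hδ _ hmid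
      rw [e1, ← hY.seg_symm x (h x) ht, show (1 - 1 / 2 : ℝ) = 1 / 2 by norm_num] at e2
      have e3 := hY.dist_seg_left_le (h x) x (h (h x)) ht
      rw [e2] at e3
      have e4 := dist_triangle x (h x) (h (h x))
      rw [hδ _ hx, hδ _ (hm hx)] at e4
      change dist x (h (h x)) = _
      linarith
    have := ih (h := h^[2]) (δ := 2 * δ) (hm.iterate 2)
      (fun x hx y hy => by
        change dist (h (h x)) (h (h y)) = _
        rw [hi _ (hm hx) _ (hm hy), hi _ hx _ hy]) h2 x hx
    rw [← Function.iterate_mul, ← pow_succ'] at this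
    rw [this]; ring

theorem dist_iterate_le {K : Set Y} {h : Y → Y} {δ : ℝ} (hm : MapsTo h K K)
    (hδ : ∀ x ∈ K, dist x (h x) = δ) (n : ℕ) : ∀ x ∈ K, dist x (h^[n] x) ≤ n * δ := by
  induction n with
  | zero => intro x _; simp
  | succ n ih =>
    intro x hx
    rw [Function.iterate_succ_apply]
    have := dist_triangle x (h x) (h^[n] (h x))
    have h2 := ih (h x) (hm hx)
    rw [hδ x hx] at this
    push_cast
    linarith

/-- Going around three pairwise parallel sets by nearest point projections, points are not
displaced, provided that they are all displaced by the same amount `δ`. If `m` is a power of two,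
compare the distance from `x` to the image of `h^[2 * m] x` in `K₃`, which is about
`(2 * m + 1) * δ`, with the length, about `2 * m * δ`, of the path through the image of `h^[m] x`
in `K₂`. -/
theorem IsParallel.displacement_eq_zero [ProperSpace Y] (hY : IsHadamard Y) {K₁ K₂ K₃ : Set Y}
    {D₁₂ D₂₃ D₁₃ δ : ℝ} (h₁₂ : IsParallel K₁ K₂ D₁₂) (h₂₃ : IsParallel K₂ K₃ D₂₃)
    (h₁₃ : IsParallel K₁ K₃ D₁₃)
    (hδ : ∀ x ∈ K₁, dist x (nearestPt K₁ (nearestPt K₃ (nearestPt K₂ x))) = δ) : δ = 0 := by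
  set h : Y → Y := fun x => nearestPt K₁ (nearestPt K₃ (nearestPt K₂ x))
  have hm : MapsTo h K₁ K₁ := fun x _ => h₁₃.symm.nearestPt_mem _
  have hi : ∀ x ∈ K₁, ∀ y ∈ K₁, dist (h x) (h y) = dist x y := fun x hx y hy =>
    h₁₂.dist_holonomy hY h₂₃ h₁₃ hx hy
  obtain ⟨x, hx⟩ := h₁₂.1
  have hδ0 : 0 ≤ δ := by rw [← hδ x hx]; exact dist_nonneg
  by_contra hne
  have hpos : 0 < δ := lt_of_le_of_ne hδ0 (Ne.symm hne)
  have key : ∀ k : ℕ, 2 * 2 ^ k * δ ^ 2 ≤ D₁₂ ^ 2 + D₂₃ ^ 2 := by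
    intro k
    set m : ℕ := 2 ^ k with hmk
    have hm1 : (1 : ℝ) ≤ m := by rw [hmk]; exact_mod_cast Nat.one_le_two_pow
    have hmem : ∀ n, h^[n] x ∈ K₁ := fun n => hm.iterate n hx
    have d1 : ∀ y ∈ K₁, dist y (h^[m] y) = m * δ := fun y hy => by
      rw [hY.dist_iterate_two_pow h₁₂.5 k hm hi hδ y hy, hmk]; push_cast; ring
    have d2 : dist x (h^[4 * m] x) = 4 * m * δ := by
      have := hY.dist_iterate_two_pow h₁₂.5 (k + 2) hm hi hδ x hx
      rw [show 2 ^ (k + 2) = 4 * m by rw [hmk, pow_add]; ring] at this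
      rw [this, hmk]; push_cast; ring
    -- the displacement of `h^[2 * m + 1]`, from that of `h^[4 * m]`
    have d3 : (2 * m + 1) * δ ≤ dist x (h^[2 * m + 1] x) := by
      have hm1' : 1 ≤ m := by exact_mod_cast hm1
      have e1 := dist_iterate_le hm hδ (2 * m - 1) _ (hmem (2 * m + 1))
      rw [← Function.iterate_add_apply, show 2 * m - 1 + (2 * m + 1) = 4 * m by omega] at e1
      have e2 := dist_triangle x (h^[2 * m + 1] x) (h^[4 * m] x)
      rw [Nat.cast_sub (by omega)] at e1
      push_cast at e1
      rw [d2] at e2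
      linarith
    set y := nearestPt K₂ (h^[m] x) with hy
    set z := nearestPt K₃ (nearestPt K₂ (h^[2 * m] x)) with hz
    have hyK : y ∈ K₂ := h₁₂.nearestPt_mem _
    have hzK : z ∈ K₃ := h₂₃.nearestPt_mem _
    have hz1 : nearestPt K₁ z = h^[2 * m + 1] x := by
      rw [Function.iterate_succ_apply']
    have a1 := (h₁₃.dist_sq hY hx hzK)
    rw [a1.2, hz1] at a1
    have a2 := (h₁₂.dist_sq hY hx hyK)
    rw [a2.2, hy, h₁₂.nearestPt_nearestPt hY (hmem m), d1 x hx] at a2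
    have a3 := (h₂₃.dist_sq hY hyK hzK).1
    rw [hz, h₂₃.dist_nearestPt_nearestPt hY hyK (h₁₂.nearestPt_mem _), hy,
      h₁₂.dist_nearestPt_nearestPt hY (hmem _) (hmem _), two_mul, Function.iterate_add_apply,
      d1 _ (hmem m)] at a3
    rw [← Function.iterate_add_apply, ← two_mul, ← hz, ← hy] at a3
    have t := dist_triangle x y z
    have a1' := a1.1
    have a2' := a2.1
    have b1 : (2 * m + 1) * δ ≤ dist x z := by
      refine le_of_sq_le_sq ?_ dist_nonneg
      rw [a1']
      have : ((2 * m + 1) * δ) ^ 2 ≤ dist x (h^[2 * m + 1] x) ^ 2 := by gcongr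
      nlinarith [sq_nonneg D₁₃]
    have hmδ : 0 < m * δ := by positivity
    have b2 : m * δ ≤ dist x y :=
      le_of_sq_le_sq (by rw [a2']; nlinarith [sq_nonneg D₁₂]) dist_nonneg
    have b3 : m * δ ≤ dist y z :=
      le_of_sq_le_sq (by rw [a3]; nlinarith [sq_nonneg D₂₃]) dist_nonneg
    have c1 : (dist x y - m * δ) * (2 * (m * δ)) ≤ D₁₂ ^ 2 := by nlinarith
    have c2 : (dist y z - m * δ) * (2 * (m * δ)) ≤ D₂₃ ^ 2 := by nlinarith
    have c3 : δ * (2 * (m * δ)) ≤ (dist x y - m * δ + (dist y z - m * δ)) * (2 * (m * δ)) := by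
      gcongr; linarith
    have : (2 : ℝ) ^ k = m := by rw [hmk]; push_cast; ring
    rw [this]
    linarith
  obtain ⟨k, hk⟩ := pow_unbounded_of_one_lt ((D₁₂ ^ 2 + D₂₃ ^ 2) / (2 * δ ^ 2))
    (one_lt_two (α := ℝ))
  rw [div_lt_iff₀ (by positivity)] at hk
  linarith [key k]

/-- Nearest point projections between minimal elements compose: the holonomy around three minimal
elements is a translation, by minimality, and so trivial. -/
theorem IsMinimalFor.nearestPt_comp [ProperSpace Y] (hY : IsHadamard Y) {K₁ K₂ K₃ : Set Y}
    (h₁ : IsMinimalFor A K₁) (h₂ : IsMinimalFor A K₂) (h₃ : IsMinimalFor A K₃) {x : Y}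
    (hx : x ∈ K₁) : nearestPt K₃ (nearestPt K₂ x) = nearestPt K₃ x := by
  obtain ⟨D₁₂, h₁₂⟩ := h₁.exists_isParallel hY h₂
  obtain ⟨D₂₃, h₂₃⟩ := h₂.exists_isParallel hY h₃
  obtain ⟨D₁₃, h₁₃⟩ := h₁.exists_isParallel hY h₃
  set h : Y → Y := fun x => nearestPt K₁ (nearestPt K₃ (nearestPt K₂ x))
  have hm : MapsTo h K₁ K₁ := fun x _ => h₁₃.symm.nearestPt_mem _
  have hi : ∀ x ∈ K₁, ∀ y ∈ K₁, dist (h x) (h y) = dist x y := fun x hx y hy =>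
    h₁₂.dist_holonomy hY h₂₃ h₁₃ hx hy
  have hconv : ∀ x ∈ K₁, ∀ y ∈ K₁, ∀ t ∈ Icc (0 : ℝ) 1,
      dist (hY.seg x y t) (h (hY.seg x y t)) ≤ (1 - t) * dist x (h x) + t * dist y (h y) := by
    intro x hx y hy t ht
    have hs := hY.seg_mem h₁₂.5 hx hy ht
    rw [hY.map_seg ht (hi _ hx _ hy) (hi _ hx _ hs) (hi _ hs _ hy)]
    exact hY.dist_seg_seg_le _ _ _ _ ht
  have hcont : ContinuousOn (fun y => dist y (h y)) K₁ := by
    have : ContinuousOn h K₁ :=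
      (LipschitzOnWith.of_dist_le_mul (K := 1) fun x hx y hy => by
        rw [hi x hx y hy]; simp).continuousOn
    exact continuous_dist.comp_continuousOn (continuousOn_id.prodMk this)
  have hle : ∀ x ∈ K₁, ∀ y ∈ K₁, dist y (h y) ≤ dist x (h x) := by
    intro x hx y hy
    have hmem : K₁ ∩ {y | dist y (h y) ≤ dist x (h x)} ∈ convexFamily A := by
      refine hY.inter_mem_convexFamily h₁.1 ?_ ?_ ⟨x, hx, le_refl (dist x (h x))⟩ ?_
      · exact hcont.preimage_isClosed_of_isClosed h₁₂.3 isClosed_Iic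
      · refine hY.geodConvex_of_seg fun y hy z hz t ht => ⟨hY.seg_mem h₁₂.5 hy.1 hz.1 ht, ?_⟩
        refine (hconv y hy.1 z hz.1 t ht).trans ?_
        have h1 := mul_le_mul_of_nonneg_left hy.2 (sub_nonneg.2 ht.2)
        have h2 := mul_le_mul_of_nonneg_left hz.2 ht.1
        linarith
      · intro ρ hρ _ h0 t
        refine le_trans ?_ (show dist (ρ.1 0) (h (ρ.1 0)) ≤ dist x (h x) from h0)
        refine GeodesicRay.le_zero_of_convex_of_bounded hY ρ (f := fun y => dist y (h y))
          (M := D₁₂ + D₂₃ + D₁₃) (fun t τ hτ => hconv _ (hρ 0) _ (hρ t) τ hτ) (fun s => ?_) t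
        have e1 := h₁₂.dist_nearestPt (hρ s)
        have e2 := h₂₃.dist_nearestPt (h₁₂.nearestPt_mem (ρ.1 s))
        have e3 := h₁₃.symm.dist_nearestPt (h₂₃.nearestPt_mem (nearestPt K₂ (ρ.1 s)))
        refine (dist_triangle4 _ (nearestPt K₂ (ρ.1 s)) (nearestPt K₃ (nearestPt K₂ (ρ.1 s)))
          _).trans ?_
        rw [e1, e2, e3]
    exact (h₁.2 hmem inter_subset_left hy).2
  have h0 := IsParallel.displacement_eq_zero hY h₁₂ h₂₃ h₁₃ (δ := dist x (h x))
    fun y hy => (hle x hx y hy).antisymm (hle y hy x hx)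
  have h1 : nearestPt K₁ (nearestPt K₃ (nearestPt K₂ x)) = x := (dist_eq_zero.1 h0).symm
  rw [← h₁₃.symm.nearestPt_nearestPt hY (h₂₃.nearestPt_mem (nearestPt K₂ x)), h1]

end Minimal

/-! ### The union of the minimal elements -/

section Union

variable {Y : Type u} [MetricSpace Y] {A : Set (IdealBoundary Y)}

/-- A non-empty closed convex set that no ray with endpoint in `A` leaves belongs to the family. -/
theorem IsHadamard.mem_convexFamily [ProperSpace Y] (hY : IsHadamard Y) {D : Set Y}
    (hDcl : IsClosed D) (hD : GeodConvex D) (hne : D.Nonempty)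
    (hray : ∀ ρ : GeodesicRay Y, ρ.endpoint ∈ A → ρ.1 0 ∈ D → ∀ t, ρ.1 t ∈ D) :
    D ∈ convexFamily A := by
  have huniv : (univ : Set Y) ∈ convexFamily A := by
    refine ⟨⟨hne.some, mem_univ _⟩, isClosed_univ, fun _ _ _ _ _ _ => mem_univ _, fun ξ _ => ?_⟩
    obtain ⟨ρ, rfl⟩ := Quotient.exists_rep ξ
    exact ⟨ρ, fun _ => mem_univ _, rfl⟩
  have := hY.inter_mem_convexFamily (D := D) huniv (by simpa using hDcl) (by simpa using hD)
    (by simpa using hne) fun ρ _ => hray ρ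
  simpa using this

namespace IsMinimalFor

variable [ProperSpace Y]

theorem subset_of_mem (hY : IsHadamard Y) {K C : Set Y} (hK : IsMinimalFor A K)
    (hC : C ∈ convexFamily A) {x : Y} (hx : x ∈ K) (hxC : x ∈ C) : K ⊆ C := by
  intro y hy
  rw [hC.2.1.mem_iff_infDist_zero hC.1, hK.infDist_eq hY hC hy hx, Metric.infDist_zero_of_mem hxC]

theorem eq_of_mem (hY : IsHadamard Y) {K L : Set Y} (hK : IsMinimalFor A K)
    (hL : IsMinimalFor A L) {x : Y} (hx : x ∈ K) (hxL : x ∈ L) : K = L :=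
  hL.eq_of_subset hK.1 (hK.subset_of_mem hY hL.1 hx hxL)

/-- The set of points at parameter `t` between two minimal elements is minimal. -/
theorem isMinimalFor_between (hY : IsHadamard Y) {K L : Set Y} {D t : ℝ} (hK : IsMinimalFor A K)
    (hL : IsMinimalFor A L) (h : IsParallel K L D) (ht : t ∈ Icc (0 : ℝ) 1)
    (hne : ({p | Metric.infDist p K ≤ t * D} ∩
      {p | Metric.infDist p L ≤ (1 - t) * D}).Nonempty) :
    IsMinimalFor A
      ({p | Metric.infDist p K ≤ t * D} ∩ {p | Metric.infDist p L ≤ (1 - t) * D}) := by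
  set M := {p | Metric.infDist p K ≤ t * D} ∩ {p | Metric.infDist p L ≤ (1 - t) * D}
  have hMA : M ∈ convexFamily A := by
    refine hY.mem_convexFamily ((isClosed_le (Metric.continuous_infDist_pt K)
      continuous_const).inter (isClosed_le (Metric.continuous_infDist_pt L) continuous_const))
      ((hY.geodConvex_infDist_le h.1 h.3 h.5 _).inter
        (hY.geodConvex_infDist_le h.2 h.4 h.6 _)) hne ?_
    exact fun ρ hρ h0 s => ⟨(hY.infDist_ray_le hK.1 ρ hρ s).trans h0.1,
      (hY.infDist_ray_le hL.1 ρ hρ s).trans h0.2⟩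
  -- a point of `M` lies at parameter `t` on the segment between its two projections
  have hpt : ∀ p ∈ M, Metric.infDist p K = t * D ∧
      p = hY.seg (nearestPt K p) (nearestPt L (nearestPt K p)) t := by
    intro p hp
    have hp1 : Metric.infDist p K ≤ t * D := hp.1
    have hp2 : Metric.infDist p L ≤ (1 - t) * D := hp.2
    obtain ⟨u1, u2⟩ := nearestPt_spec h.1 h.3 p
    obtain ⟨v1, v2⟩ := nearestPt_spec h.2 h.4 p
    set w := nearestPt K p
    have e1 : D ≤ dist w (nearestPt L p) := by
      rw [← h.7 w u1]; exact Metric.infDist_le_dist_of_mem v1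
    have e2 := dist_triangle w p (nearestPt L p)
    rw [dist_comm w p, ← u2, ← v2] at e2
    have e3 : nearestPt L w = nearestPt L p :=
      hY.eq_nearestPt h.4 h.6 v1 (by rw [h.7 w u1]; linarith)
    have e4 : dist w (nearestPt L w) = D := h.dist_nearestPt u1
    refine ⟨by linarith, hY.eq_seg ht ?_ ?_⟩
    · rw [e4, dist_comm, ← u2]; linarith
    · rw [e4, e3, ← v2]; linarith
  refine ⟨hMA, fun N hN hNM p hp => ?_⟩
  obtain ⟨hp1, hp2⟩ := hpt p hp
  set w := nearestPt K p
  have hwK : w ∈ K := h.symm.nearestPt_mem p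
  obtain ⟨n, hn⟩ := hN.1
  have hd : Metric.infDist w N ≤ t * D := by
    rw [hK.infDist_eq hY hN hwK (h.symm.nearestPt_mem n), ← (hpt n (hNM hn)).1,
      (nearestPt_spec h.1 h.3 n).2, dist_comm]
    exact Metric.infDist_le_dist_of_mem hn
  obtain ⟨n', hn', hwn⟩ := hN.2.1.exists_infDist_eq_dist hN.1 w
  have h1 : nearestPt K n' = w :=
    hY.eq_nearestPt h.3 h.5 hwK (by rw [(hpt n' (hNM hn')).1, dist_comm, ← hwn]; exact hd)
  have h2 := (hpt n' (hNM hn')).2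
  rw [h1, ← hp2] at h2
  rwa [← h2]

/-- A point on a segment between points of two minimal elements lies in the minimal element of the
points at the same parameter between the two, as the distances from them are convex functions. -/
theorem exists_minimal_seg (hY : IsHadamard Y) {K L : Set Y} (hK : IsMinimalFor A K)
    (hL : IsMinimalFor A L) {x y : Y} (hx : x ∈ K) (hy : y ∈ L) {t : ℝ} (ht : t ∈ Icc (0 : ℝ) 1) :
    ∃ M, IsMinimalFor A M ∧ hY.seg x y t ∈ M := by
  obtain ⟨D, h⟩ := hK.exists_isParallel hY hL
  have hmem : hY.seg x y t ∈
      {p | Metric.infDist p K ≤ t * D} ∩ {p | Metric.infDist p L ≤ (1 - t) * D} := by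
    constructor
    · refine (hY.infDist_seg_le h.1 h.3 h.5 x y ht).trans (le_of_eq ?_)
      rw [Metric.infDist_zero_of_mem hx, h.8 y hy]; ring
    · refine (hY.infDist_seg_le h.2 h.4 h.6 x y ht).trans (le_of_eq ?_)
      rw [Metric.infDist_zero_of_mem hy, h.7 x hx]; ring
  exact ⟨_, isMinimalFor_between hY hK hL h ht ⟨_, hmem⟩, hmem⟩

/-- A limit of minimal elements is minimal. -/
theorem isMinimalFor_limit (hY : IsHadamard Y) {K : ℕ → Set Y} {ε : ℕ → ℝ}
    (hK : ∀ n, IsMinimalFor A (K n)) (hε : Tendsto ε atTop (𝓝 0))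
    (hne : (⋂ n, {x | Metric.infDist x (K n) ≤ ε n}).Nonempty) :
    IsMinimalFor A (⋂ n, {x | Metric.infDist x (K n) ≤ ε n}) := by
  set M := ⋂ n, {x | Metric.infDist x (K n) ≤ ε n}
  have hmem : ∀ x, x ∈ M ↔ ∀ n, Metric.infDist x (K n) ≤ ε n := fun x => mem_iInter
  have hMA : M ∈ convexFamily A := by
    refine hY.mem_convexFamily (isClosed_iInter fun n =>
      isClosed_le (Metric.continuous_infDist_pt _) continuous_const) (GeodConvex.iInter fun n =>
        hY.geodConvex_infDist_le (hK n).1.1 (hK n).1.2.1 (hK n).1.2.2.1 _) hne ?_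
    intro ρ hρ h0 t
    rw [hmem] at h0 ⊢
    exact fun n => (hY.infDist_ray_le (hK n).1 ρ hρ t).trans (h0 n)
  refine ⟨hMA, fun N hN hNM p hp => ?_⟩
  rw [hN.2.1.mem_iff_infDist_zero hN.1]
  obtain ⟨m, hm⟩ := hN.1
  have key : ∀ n, Metric.infDist p N ≤ ε n + ε n := by
    intro n
    obtain ⟨u1, u2⟩ := nearestPt_spec (hK n).1.1 (hK n).1.2.1 p
    obtain ⟨v1, v2⟩ := nearestPt_spec (hK n).1.1 (hK n).1.2.1 m
    have e1 := Metric.infDist_le_infDist_add_dist (s := N) (x := p) (y := nearestPt (K n) p)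
    have e2 : Metric.infDist (nearestPt (K n) p) N ≤ ε n := by
      rw [(hK n).infDist_eq hY hN u1 v1]
      refine (Metric.infDist_le_dist_of_mem hm).trans ?_
      rw [dist_comm, ← v2]
      exact (hmem m).1 (hNM hm) n
    have e3 := (hmem p).1 hp n
    rw [← u2] at e1
    linarith
  have h2 := ge_of_tendsto' (hε.add hε) key
  rw [add_zero] at h2
  exact h2.antisymm Metric.infDist_nonneg

end IsMinimalFor

theorem IsMinimalFor.mem_minimalUnion {K : Set Y} (hK : IsMinimalFor A K) {x : Y} (hx : x ∈ K) :
    x ∈ minimalUnion A :=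
  mem_sUnion.2 ⟨K, hK, hx⟩

theorem mem_minimalUnion_iff {x : Y} : x ∈ minimalUnion A ↔ ∃ K, IsMinimalFor A K ∧ x ∈ K :=
  mem_sUnion

theorem IsHadamard.geodConvex_minimalUnion [ProperSpace Y] (hY : IsHadamard Y) :
    GeodConvex (minimalUnion A) := by
  refine hY.geodConvex_of_seg fun x hx y hy t ht => ?_
  obtain ⟨K, hK, hxK⟩ := mem_minimalUnion_iff.1 hx
  obtain ⟨L, hL, hyL⟩ := mem_minimalUnion_iff.1 hy
  obtain ⟨M, hM, h⟩ := hK.exists_minimal_seg hY hL hxK hyL ht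
  exact hM.mem_minimalUnion h

/-! ### The product decomposition -/

/-- Closed convex subsets of Hadamard spaces are Hadamard spaces. -/
theorem IsHadamard.subtype (hY : IsHadamard Y) {S : Set Y} (hne : S.Nonempty) (hcl : IsClosed S)
    (hS : GeodConvex S) : IsHadamard S where
  nonempty := hne.to_subtype
  complete := by
    have := hY.complete
    exact hcl.completeSpace_coe
  geodesic x y := by
    obtain ⟨γ, h0, h1, hγ⟩ := hY.geodesic x y
    have hd : (0 : ℝ) ≤ dist x y := dist_nonneg
    have hmem : ∀ s ∈ Icc (0 : ℝ) (dist x y), γ s ∈ S := by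
      intro s hs
      refine hS x x.2 y y.2 _ ?_
      have e1 := hγ 0 ⟨le_rfl, hd⟩ s hs
      have e2 := hγ s hs (dist x y) ⟨hd, le_rfl⟩
      rw [h0, zero_sub, abs_neg, abs_of_nonneg hs.1] at e1
      rw [show γ (dist x y) = y from h1, abs_sub_comm, abs_of_nonneg (by linarith [hs.2])] at e2
      rw [e1, e2, Subtype.dist_eq]; ring
    refine ⟨fun s => ⟨γ (projIcc 0 (dist x y) hd s), hmem _ (projIcc 0 (dist x y) hd s).2⟩,
      ?_, ?_, ?_⟩
    · ext; simpa using h0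
    · ext; simpa using (show γ (dist x y) = y from h1)
    · intro s hs t ht
      rw [Subtype.dist_eq]
      simp only [projIcc_of_mem hd hs, projIcc_of_mem hd ht]
      exact hγ s hs t ht
  comparison x y z p q := hY.comparison x y z p q

theorem WithLp.prod_two_dist {C Z : Type*} [MetricSpace C] [MetricSpace Z]
    (x y : WithLp 2 (C × Z)) : dist x y = √(dist x.fst y.fst ^ 2 + dist x.snd y.snd ^ 2) := by
  have h : 0 < (2 : ENNReal).toReal := by norm_num
  refine (WithLp.prod_dist_eq_add h x y).trans ?_
  rw [Real.sqrt_eq_rpow]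
  norm_num

/-- The slice over `c` of the union of the minimal elements: the points that project to `c` in the
minimal element `C`. -/
def slice (A : Set (IdealBoundary Y)) (C : Set Y) (c : Y) : Set Y :=
  {z | z ∈ minimalUnion A ∧ nearestPt C z = c}

namespace IsMinimalFor

variable [ProperSpace Y] {C : Set Y} {c : Y}

theorem nearestPt_mem_slice (hY : IsHadamard Y) (hC : IsMinimalFor A C) (hc : c ∈ C) {K : Set Y}
    (hK : IsMinimalFor A K) : nearestPt K c ∈ slice A C c := by
  obtain ⟨D, h⟩ := hC.exists_isParallel hY hK
  exact ⟨hK.mem_minimalUnion (h.nearestPt_mem c), h.nearestPt_nearestPt hY hc⟩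

theorem geodConvex_slice (hY : IsHadamard Y) (hC : IsMinimalFor A C) :
    GeodConvex (slice A C c) := by
  refine hY.geodConvex_of_seg fun x hx y hy t ht => ?_
  obtain ⟨K, hK, hxK⟩ := mem_minimalUnion_iff.1 hx.1
  obtain ⟨L, hL, hyL⟩ := mem_minimalUnion_iff.1 hy.1
  obtain ⟨M, hM, hpM⟩ := hK.exists_minimal_seg hY hL hxK hyL ht
  refine ⟨hM.mem_minimalUnion hpM, ?_⟩
  obtain ⟨D, h⟩ := hK.exists_isParallel hY hL
  have hyx : nearestPt L x = y := by
    have e := hL.nearestPt_comp hY hC hK hyL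
    rw [hy.2, ← hx.2, hK.nearestPt_comp hY hC hK hxK,
      hY.nearestPt_of_mem h.3 h.5 hxK] at e
    rw [e, h.symm.nearestPt_nearestPt hY hyL]
  have hdist : dist x y = D := by rw [← hyx]; exact h.dist_nearestPt hxK
  -- the point of the segment projects to `x` in `K`
  have hpx : nearestPt K (hY.seg x y t) = x := by
    refine hY.eq_nearestPt h.3 h.5 hxK ?_
    rw [dist_comm, hY.dist_left_seg x y ht, hdist]
    obtain ⟨u1, u2⟩ := nearestPt_spec h.1 h.3 (hY.seg x y t)
    have e1 : D ≤ dist (nearestPt K (hY.seg x y t)) y := by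
      rw [← h.8 y hyL, dist_comm]; exact Metric.infDist_le_dist_of_mem u1
    have e2 := dist_triangle (nearestPt K (hY.seg x y t)) (hY.seg x y t) y
    rw [dist_comm _ (hY.seg x y t), ← u2, hY.dist_seg_right x y ht, hdist] at e2
    linarith
  rw [← hM.nearestPt_comp hY hK hC hpM, hpx, hx.2]

theorem isClosed_slice (hY : IsHadamard Y) (hC : IsMinimalFor A C) : IsClosed (slice A C c) := by
  refine isClosed_of_closure_subset fun z hz => ?_
  obtain ⟨w, hw, hwz⟩ := mem_closure_iff_seq_limit.1 hz
  choose K hK hwK using fun n => mem_minimalUnion_iff.1 (hw n).1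
  have hε : Tendsto (fun n => dist z (w n)) atTop (𝓝 0) := by
    simpa using (tendsto_const_nhds (x := z)).dist hwz
  have hzM : z ∈ ⋂ n, {x | Metric.infDist x (K n) ≤ dist z (w n)} :=
    mem_iInter.2 fun n => Metric.infDist_le_dist_of_mem (hwK n)
  refine ⟨(isMinimalFor_limit hY hK hε ⟨z, hzM⟩).mem_minimalUnion hzM, ?_⟩
  have hcont : Continuous (nearestPt C) :=
    (LipschitzWith.of_dist_le_mul (K := 1) fun x y => by
      simpa using hY.dist_nearestPt_le hC.1.1 hC.1.2.1 hC.1.2.2.1 x y).continuous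
  exact tendsto_nhds_unique ((hcont.tendsto z).comp hwz)
    (tendsto_const_nhds.congr fun n => (hw n).2.symm)

/-- The union of the minimal elements is the metric product of a minimal element `C` and a
slice. -/
theorem exists_product (hY : IsHadamard Y) (hC : IsMinimalFor A C) (hc : c ∈ C) :
    ∃ φ : WithLp 2 (C × slice A C c) ≃ᵢ minimalUnion A, LayersAreMinimal A φ := by
  choose K hK hzK using fun z : slice A C c => mem_minimalUnion_iff.1 z.2.1
  have hpar : ∀ z, ∃ D, IsParallel C (K z) D := fun z => hC.exists_isParallel hY (hK z)
  have hmem : ∀ (x : Y) z, nearestPt (K z) x ∈ K z := fun x z => by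
    obtain ⟨D, h⟩ := hpar z; exact h.nearestPt_mem x
  have hbase : ∀ z : slice A C c, nearestPt (K z) c = z := fun z => by
    obtain ⟨D, h⟩ := hpar z
    conv_lhs => rw [← z.2.2]
    exact h.symm.nearestPt_nearestPt hY (hzK z)
  set f : WithLp 2 (C × slice A C c) → minimalUnion A := fun x =>
    ⟨nearestPt (K x.snd) x.fst, (hK x.snd).mem_minimalUnion (hmem _ _)⟩ with hf
  have hiso : Isometry f := by
    refine Isometry.of_dist_eq fun x y => ?_
    rw [WithLp.prod_two_dist, Subtype.dist_eq, Subtype.dist_eq, Subtype.dist_eq]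
    obtain ⟨D, h⟩ := (hK x.snd).exists_isParallel hY (hK y.snd)
    obtain ⟨E, h'⟩ := hpar y.snd
    have e1 := (h.dist_sq hY (hmem x.fst x.snd) (hmem y.fst y.snd)).1
    rw [hC.nearestPt_comp hY (hK x.snd) (hK y.snd) x.fst.2,
      h'.dist_nearestPt_nearestPt hY x.fst.2 y.fst.2] at e1
    have e2 : dist (x.snd : Y) y.snd = D := by
      have := hC.nearestPt_comp hY (hK x.snd) (hK y.snd) hc
      rw [hbase, hbase] at this
      rw [← this]
      exact h.dist_nearestPt (hzK _)
    rw [e2, add_comm, ← e1, Real.sqrt_sq dist_nonneg]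
  have hsurj : Function.Surjective f := by
    rintro ⟨y, hy⟩
    obtain ⟨L, hL, hyL⟩ := mem_minimalUnion_iff.1 hy
    obtain ⟨D, h⟩ := hC.exists_isParallel hY hL
    let z : slice A C c := ⟨nearestPt L c, hC.nearestPt_mem_slice hY hc hL⟩
    have hKL : K z = L := (hK z).eq_of_mem hY hL (hzK z) (h.nearestPt_mem c)
    refine ⟨WithLp.toLp 2 (⟨nearestPt C y, h.symm.nearestPt_mem y⟩, z), Subtype.ext ?_⟩
    change nearestPt (K z) (nearestPt C y) = y
    rw [hKL, h.symm.nearestPt_nearestPt hY hyL]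
  have hlayer : ∀ z,
      (range fun x : C => ((f (WithLp.toLp 2 (x, z)) : minimalUnion A) : Y)) = K z := by
    intro z
    obtain ⟨D, h⟩ := hpar z
    refine Subset.antisymm (range_subset_iff.2 fun x => hmem _ _) fun y hy => ?_
    exact ⟨⟨nearestPt C y, h.symm.nearestPt_mem y⟩, h.symm.nearestPt_nearestPt hY hy⟩
  let φ : WithLp 2 (C × slice A C c) ≃ᵢ minimalUnion A :=
    ⟨Equiv.ofBijective f ⟨hiso.injective, hsurj⟩, hiso⟩
  have hφ : ∀ z, productLayer φ z = K z := hlayer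
  refine ⟨φ, fun L => ⟨fun hL => ?_, ?_⟩⟩
  · obtain ⟨D, h⟩ := hC.exists_isParallel hY hL
    let z : slice A C c := ⟨nearestPt L c, hC.nearestPt_mem_slice hY hc hL⟩
    have hKL : K z = L := (hK z).eq_of_mem hY hL (hzK z) (h.nearestPt_mem c)
    exact ⟨z, by rw [hφ, hKL]⟩
  · rintro ⟨z, rfl⟩
    rw [hφ]
    exact hK z

theorem isHadamard_slice (hY : IsHadamard Y) (hC : IsMinimalFor A C) (hc : c ∈ C) :
    IsHadamard (slice A C c) :=
  hY.subtype ⟨_, hC.nearestPt_mem_slice hY hc hC⟩ (hC.isClosed_slice hY) (hC.geodConvex_slice hY)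

theorem compactSpace_slice (hY : IsHadamard Y) (hC : IsMinimalFor A C)
    {r : ℝ} (hr : ∀ z ∈ slice A C c, dist c z ≤ r) : CompactSpace (slice A C c) := by
  rw [← isCompact_iff_compactSpace]
  exact (isCompact_closedBall c r).of_isClosed_subset (hC.isClosed_slice hY) fun z hz => by
    rw [Metric.mem_closedBall, dist_comm]; exact hr z hz

/-- If all minimal elements come within distance `R` of some point, the slices are bounded. -/
theorem dist_slice_le (hY : IsHadamard Y) (hC : IsMinimalFor A C) {o : Y} {R : ℝ}
    (hR : ∀ K ∈ convexFamily A, Metric.infDist o K ≤ R) {z : Y} (hz : z ∈ slice A C c) :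
    dist c z ≤ R + R := by
  obtain ⟨K, hK, hzK⟩ := mem_minimalUnion_iff.1 hz.1
  obtain ⟨D, h⟩ := hC.exists_isParallel hY hK
  have e1 : dist c z = D := by rw [← hz.2, dist_comm]; exact h.symm.dist_nearestPt hzK
  obtain ⟨u1, u2⟩ := nearestPt_spec h.1 h.3 o
  obtain ⟨v1, v2⟩ := nearestPt_spec h.2 h.4 o
  have e2 : D ≤ dist (nearestPt C o) (nearestPt K o) := by
    rw [← h.7 _ u1]; exact Metric.infDist_le_dist_of_mem v1
  have e3 := dist_triangle_left (nearestPt C o) (nearestPt K o) o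
  rw [← u2, ← v2] at e3
  linarith [hR C hC.1, hR K hK.1]

/-- If `A` is the whole ideal boundary, a slice contains no ray, as such a ray would be asymptotic
to one in `C` with the same initial point. -/
theorem exists_dist_slice_le_of_univ (hY : IsHadamard Y)
    (hC : IsMinimalFor (univ : Set (IdealBoundary Y)) C) (hc : c ∈ C) :
    ∃ r : ℝ, ∀ z ∈ slice univ C c, dist c z ≤ r := by
  by_contra! hne
  have hcs : c ∈ slice univ C c :=
    ⟨hC.mem_minimalUnion hc, hY.nearestPt_of_mem hC.1.2.1 hC.1.2.2.1 hc⟩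
  obtain ⟨ρ, h0, hρ⟩ := hY.exists_ray_of_unbounded (hC.isClosed_slice hY)
    (hC.geodConvex_slice hY) hcs hne
  obtain ⟨σ, hσ, he⟩ := hC.1.2.2.2 (mem_univ ρ.endpoint)
  obtain ⟨τ, hτ0, hτσ, hτ⟩ := hY.exists_asymptotic_mem hC.1.2.1 hC.1.2.2.1 hc σ hσ
  have has : Asymptotic τ ρ :=
    GeodesicRay.endpoint_eq_iff.1 ((GeodesicRay.endpoint_eq_iff.2 hτσ).trans he)
  have h1 := GeodesicRay.eq_of_asymptotic hY has (by rw [hτ0, h0]) 1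
  have h2 : nearestPt C (ρ.1 1) = ρ.1 1 :=
    hY.nearestPt_of_mem hC.1.2.1 hC.1.2.2.1 (h1 ▸ hτ 1)
  rw [(hρ 1).2, ← h0] at h2
  have h3 := ρ.dist_zero 1
  rw [← h2, dist_self] at h3
  simp at h3

end IsMinimalFor

/-! ### Centers -/

theorem exists_isCenter {Z : Type*} [MetricSpace Z] [CompactSpace Z] [Nonempty Z] :
    ∃ z : Z, IsCenter z := by
  have hb : ∀ z : Z, BddAbove (range fun w => dist z w) := fun z =>
    (isCompact_range (by fun_prop)).bddAbove
  have hlip : LipschitzWith 1 fun z : Z => ⨆ w, dist z w := by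
    refine LipschitzWith.of_le_add fun x y => ciSup_le fun w => ?_
    have := le_ciSup (hb y) w
    linarith [dist_triangle x y w]
  obtain ⟨z, -, hz⟩ := isCompact_univ.exists_isMinOn (univ_nonempty (α := Z))
    hlip.continuous.continuousOn
  refine ⟨z, fun y r hr w => (le_ciSup (hb z) w).trans ?_⟩
  exact (hz (mem_univ y)).trans (ciSup_le hr)

theorem IsCenter.eq {Z : Type u} [MetricSpace Z] [CompactSpace Z] (hZ : IsHadamard Z) {x y : Z}
    (hx : IsCenter x) (hy : IsCenter y) : x = y := by
  obtain ⟨w, -, hw⟩ := isCompact_univ.exists_isMaxOn ⟨x, mem_univ x⟩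
    (f := fun w => dist x w) (by fun_prop)
  have hwx : ∀ v, dist x v ≤ dist x w := fun v => hw (mem_univ v)
  have hwy := hy x _ hwx
  have key : ∀ v, dist (hZ.seg x y (1 / 2)) v ≤ √(dist x w ^ 2 - 1 / 4 * dist x y ^ 2) := by
    intro v
    refine Real.le_sqrt_of_sq_le ?_
    have h1 := hZ.dist_seg_sq_le x y v (t := 1 / 2) (by norm_num)
    have h2 : dist x v ^ 2 ≤ dist x w ^ 2 := by gcongr; exact hwx v
    have h3 : dist y v ^ 2 ≤ dist x w ^ 2 := by gcongr; exact hwy v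
    rw [dist_comm v, dist_comm v, dist_comm v] at h1
    linarith
  have h1 := hx _ _ key w
  have h2 : 0 ≤ dist x w ^ 2 - 1 / 4 * dist x y ^ 2 := by
    have : dist x y ^ 2 ≤ dist x w ^ 2 := by gcongr; exact hwx y
    nlinarith [sq_nonneg (dist x y)]
  have h3 : dist x w ^ 2 ≤ √(dist x w ^ 2 - 1 / 4 * dist x y ^ 2) ^ 2 := by gcongr
  rw [Real.sq_sqrt h2] at h3
  have h4 : dist x y ^ 2 ≤ 0 := by linarith
  exact dist_eq_zero.1 (pow_eq_zero_iff two_ne_zero |>.1 (le_antisymm h4 (sq_nonneg _)))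

section Layers

variable {C Z : Type u} [MetricSpace C] [MetricSpace Z]

/-- The distance of two layers is the distance of the corresponding points of `Z`. -/
theorem infDist_productLayer {S : Set Y} (φ : WithLp 2 (C × Z) ≃ᵢ S) {z w : Z} {x : Y}
    (hx : x ∈ productLayer φ z) : Metric.infDist x (productLayer φ w) = dist z w := by
  obtain ⟨c, rfl⟩ := hx
  have hd : ∀ c' : C, dist (φ (WithLp.toLp 2 (c, z)) : Y) (φ (WithLp.toLp 2 (c', w)))
      = √(dist c c' ^ 2 + dist z w ^ 2) := fun c' => by
    rw [← Subtype.dist_eq, φ.isometry.dist_eq, WithLp.prod_two_dist]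
    rfl
  have hmem : ∀ c' : C, (φ (WithLp.toLp 2 (c', w)) : Y) ∈ productLayer φ w := fun c' => ⟨c', rfl⟩
  refine le_antisymm ?_ (le_infDist ⟨_, hmem c⟩ ?_)
  · refine (Metric.infDist_le_dist_of_mem (hmem c)).trans (le_of_eq ?_)
    simp [hd]
  · rintro _ ⟨c', rfl⟩
    refine le_of_le_of_eq ?_ (hd c').symm
    exact Real.le_sqrt_of_sq_le (by nlinarith [sq_nonneg (dist c c')])

/-- A characterization of the layers over centers that does not involve the product
decomposition. -/
theorem isCenter_iff [Nonempty C] {φ : WithLp 2 (C × Z) ≃ᵢ minimalUnion A}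
    (hφ : LayersAreMinimal A φ) (z₀ : Z) :
    IsCenter z₀ ↔ ∀ K, IsMinimalFor A K → ∀ r : ℝ,
      (∀ L, IsMinimalFor A L → ∀ x ∈ K, Metric.infDist x L ≤ r) →
      ∀ L, IsMinimalFor A L → ∀ x ∈ productLayer φ z₀, Metric.infDist x L ≤ r := by
  obtain ⟨c⟩ := ‹Nonempty C›
  constructor
  · intro h K hK r hr L hL x hx
    obtain ⟨z, rfl⟩ := (hφ K).1 hK
    obtain ⟨w, rfl⟩ := (hφ L).1 hL
    rw [infDist_productLayer φ hx]
    refine h z r (fun v => ?_) w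
    rw [← infDist_productLayer φ (w := v) ⟨c, rfl⟩]
    exact hr _ ((hφ _).2 ⟨v, rfl⟩) _ ⟨c, rfl⟩
  · intro h z r hr w
    rw [← infDist_productLayer φ (w := w) ⟨c, rfl⟩]
    refine h _ ((hφ _).2 ⟨z, rfl⟩) r (fun L hL x hx => ?_) _ ((hφ _).2 ⟨w, rfl⟩) _ ⟨c, rfl⟩
    obtain ⟨v, rfl⟩ := (hφ L).1 hL
    rw [infDist_productLayer φ hx]
    exact hr v

end Layers

theorem IsCentralMinimal.eq {K L : Set Y} (hK : IsCentralMinimal A K)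
    (hL : IsCentralMinimal A L) : K = L := by
  obtain ⟨C, Z, _, _, φ, z, hC, hZ, _, hφ, hz, rfl⟩ := hK
  obtain ⟨C', Z', _, _, φ', z', hC', hZ', _, hφ', hz', rfl⟩ := hL
  obtain ⟨w, hw⟩ := (hφ _).1 ((hφ' _).2 ⟨z', rfl⟩)
  have := hC.nonempty
  have := hC'.nonempty
  have hwc : IsCenter w := by
    rw [isCenter_iff hφ, ← hw]
    exact (isCenter_iff hφ' z').1 hz'
  rw [hw, hz.eq hZ hwc]

theorem IsMinimalFor.existsUnique_isCentralMinimal [ProperSpace Y] (hY : IsHadamard Y) {C : Set Y}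
    (hC : IsMinimalFor A C) {c : Y} (hc : c ∈ C) {r : ℝ}
    (hr : ∀ z ∈ slice A C c, dist c z ≤ r) : ∃! K, IsCentralMinimal A K := by
  obtain ⟨φ, hφ⟩ := hC.exists_product hY hc
  have hcomp := hC.compactSpace_slice hY hr
  have hZ := hC.isHadamard_slice hY hc
  have := hZ.nonempty
  obtain ⟨z, hz⟩ := exists_isCenter (Z := slice A C c)
  have hK : IsCentralMinimal A (productLayer φ z) :=
    ⟨C, slice A C c, inferInstance, inferInstance, φ, z,
      hY.subtype hC.1.1 hC.1.2.1 hC.1.2.2.1, hZ, hcomp, hφ, hz, rfl⟩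
  exact ⟨_, hK, fun L hL => hL.eq hK⟩

end Union

/-! ### The Tits angle as an asymptotic comparison angle -/

section Tits

variable {Y : Type u} [MetricSpace Y]

namespace GeodesicRay

/-- The cosine of the comparison angle, at the common initial point of two rays, for the points
`ρ s` and `σ t`. -/
noncomputable def compCos (ρ σ : GeodesicRay Y) (s t : ℝ≥0) : ℝ :=
  ((s : ℝ) ^ 2 + (t : ℝ) ^ 2 - dist (ρ.1 s) (σ.1 t) ^ 2) / (2 * s * t)

/-- The cosine of the asymptotic comparison angle of two rays with the same initial point. As
comparison angles grow with time, it is an infimum as well as a limit. -/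
noncomputable def cosInf (ρ σ : GeodesicRay Y) : ℝ :=
  ⨅ t : Ioi (0 : ℝ≥0), compCos ρ σ t t

theorem compCos_comm (ρ σ : GeodesicRay Y) (s t : ℝ≥0) : compCos ρ σ s t = compCos σ ρ t s := by
  rw [compCos, compCos, dist_comm, add_comm ((s : ℝ) ^ 2), mul_right_comm]

theorem comparisonAngle_eq {ρ σ : GeodesicRay Y} (h0 : ρ.1 0 = σ.1 0) (s t : ℝ≥0) :
    comparisonAngle (ρ.1 0) (ρ.1 s) (σ.1 t) = Real.arccos (compCos ρ σ s t) := by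
  rw [comparisonAngle, compCos, ρ.dist_zero, h0, σ.dist_zero]

theorem dist_sq_eq (ρ σ : GeodesicRay Y) {s t : ℝ≥0} (hs : 0 < s) (ht : 0 < t) :
    dist (ρ.1 s) (σ.1 t) ^ 2 = (s : ℝ) ^ 2 + (t : ℝ) ^ 2 - 2 * s * t * compCos ρ σ s t := by
  have hs' : (0 : ℝ) < s := hs
  have ht' : (0 : ℝ) < t := ht
  rw [compCos]; field_simp; ring

theorem abs_compCos_le {ρ σ : GeodesicRay Y} (h0 : ρ.1 0 = σ.1 0) {s t : ℝ≥0} (hs : 0 < s)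
    (ht : 0 < t) : |compCos ρ σ s t| ≤ 1 := by
  have hs' : (0 : ℝ) < s := hs
  have ht' : (0 : ℝ) < t := ht
  have h1 := abs_dist_sub_le (ρ.1 0) (ρ.1 s) (σ.1 t)
  have h2 := dist_triangle_left (ρ.1 s) (σ.1 t) (ρ.1 0)
  rw [ρ.dist_zero, h0, σ.dist_zero] at h2
  have h3 := dist_triangle (σ.1 0) (σ.1 t) (ρ.1 s)
  have h4 := dist_triangle (σ.1 0) (ρ.1 s) (σ.1 t)
  rw [σ.dist_zero, ← h0, ρ.dist_zero, dist_comm (σ.1 t)] at h3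
  rw [σ.dist_zero, ← h0, ρ.dist_zero] at h4
  have h5 := dist_nonneg (x := ρ.1 s) (y := σ.1 t)
  rw [compCos, abs_le, le_div_iff₀ (by positivity), div_le_iff₀ (by positivity)]
  constructor
  · nlinarith
  · have : ((s : ℝ) - t) ^ 2 ≤ dist (ρ.1 s) (σ.1 t) ^ 2 :=
      sq_le_sq' (by linarith) (by linarith)
    nlinarith

theorem compCos_le_left (hY : IsHadamard Y) {ρ σ : GeodesicRay Y} (h0 : ρ.1 0 = σ.1 0)
    {s s' t : ℝ≥0} (hs' : 0 < s') (hss : s' ≤ s) (ht : 0 < t) :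
    compCos ρ σ s t ≤ compCos ρ σ s' t := by
  have hs : 0 < s := hs'.trans_le hss
  have e := eq_seg hY ρ hss hs
  have a1 : (0 : ℝ) < s := hs
  have a2 : (0 : ℝ) < s' := hs'
  have a3 : (0 : ℝ) < t := ht
  have a4 : (s' : ℝ) ≤ s := hss
  have h01 : (s' / s : ℝ) ∈ Icc (0 : ℝ) 1 := ⟨by positivity, by rw [div_le_one a1]; exact a4⟩
  have h := hY.dist_seg_sq_le (ρ.1 0) (ρ.1 s) (σ.1 t) h01
  rw [← e, ρ.dist_zero, h0, dist_comm (σ.1 t) (σ.1 0), σ.dist_zero, dist_comm (σ.1 t) (ρ.1 s'),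
    dist_comm (σ.1 t) (ρ.1 s)] at h
  rw [compCos, compCos, div_le_div_iff₀ (by positivity) (by positivity)]
  have h2 := mul_le_mul_of_nonneg_left h (show (0 : ℝ) ≤ 2 * s * t by positivity)
  have e1 : 2 * (s : ℝ) * t * ((1 - s' / s) * (t : ℝ) ^ 2 + s' / s * dist (ρ.1 s) (σ.1 t) ^ 2 -
      s' / s * (1 - s' / s) * (s : ℝ) ^ 2) = 2 * t * ((s - s') * (t : ℝ) ^ 2 +
      s' * dist (ρ.1 s) (σ.1 t) ^ 2 - s' * (s - s') * s) := by
    field_simp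
  rw [e1] at h2
  linarith

theorem compCos_le (hY : IsHadamard Y) {ρ σ : GeodesicRay Y} (h0 : ρ.1 0 = σ.1 0)
    {s s' t t' : ℝ≥0} (hs' : 0 < s') (hss : s' ≤ s) (ht' : 0 < t') (htt : t' ≤ t) :
    compCos ρ σ s t ≤ compCos ρ σ s' t' := by
  refine (compCos_le_left hY h0 hs' hss (ht'.trans_le htt)).trans ?_
  rw [compCos_comm, compCos_comm ρ]
  exact compCos_le_left hY h0.symm ht' htt hs'

theorem bddBelow_compCos {ρ σ : GeodesicRay Y} (h0 : ρ.1 0 = σ.1 0) :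
    BddBelow (range fun t : Ioi (0 : ℝ≥0) => compCos ρ σ t t) :=
  ⟨-1, by rintro _ ⟨t, rfl⟩; exact (abs_le.1 (abs_compCos_le h0 t.2 t.2)).1⟩

theorem cosInf_le (hY : IsHadamard Y) {ρ σ : GeodesicRay Y} (h0 : ρ.1 0 = σ.1 0) {s t : ℝ≥0}
    (hs : 0 < s) (ht : 0 < t) : cosInf ρ σ ≤ compCos ρ σ s t := by
  have hm : 0 < max s t := lt_max_of_lt_left hs
  exact (ciInf_le (bddBelow_compCos h0) ⟨max s t, hm⟩).trans
    (compCos_le hY h0 hs (le_max_left _ _) ht (le_max_right _ _))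

theorem le_cosInf {ρ σ : GeodesicRay Y} {c : ℝ} (h : ∀ t : ℝ≥0, 0 < t → c ≤ compCos ρ σ t t) :
    c ≤ cosInf ρ σ := by
  have : Nonempty (Ioi (0 : ℝ≥0)) := ⟨⟨1, mem_Ioi.2 zero_lt_one⟩⟩
  exact le_ciInf fun t => h t t.2

theorem abs_cosInf_le (hY : IsHadamard Y) {ρ σ : GeodesicRay Y} (h0 : ρ.1 0 = σ.1 0) :
    |cosInf ρ σ| ≤ 1 :=
  abs_le.2 ⟨le_cosInf fun _ ht => (abs_le.1 (abs_compCos_le h0 ht ht)).1,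
    (cosInf_le hY h0 one_pos one_pos).trans (abs_le.1 (abs_compCos_le h0 one_pos one_pos)).2⟩

theorem tendsto_compCos (hY : IsHadamard Y) {ρ σ : GeodesicRay Y} (h0 : ρ.1 0 = σ.1 0) :
    Tendsto (fun t => compCos ρ σ t t) atTop (𝓝 (cosInf ρ σ)) := by
  have : Nonempty (Ioi (0 : ℝ≥0)) := ⟨⟨1, mem_Ioi.2 zero_lt_one⟩⟩
  refine tendsto_order.2 ⟨fun a ha => ?_, fun a ha => ?_⟩
  · filter_upwards [eventually_gt_atTop 0] with t ht using ha.trans_le (cosInf_le hY h0 ht ht)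
  · obtain ⟨T, hT⟩ := exists_lt_of_ciInf_lt ha
    filter_upwards [eventually_ge_atTop T.1] with t ht
    exact (compCos_le hY h0 T.2 ht T.2 ht).trans_lt hT

theorem tendsto_compCos_mul (hY : IsHadamard Y) {ρ σ : GeodesicRay Y} (h0 : ρ.1 0 = σ.1 0)
    {p q : ℝ≥0} (hp : 0 < p) (hq : 0 < q) :
    Tendsto (fun t => compCos ρ σ (p * t) (q * t)) atTop (𝓝 (cosInf ρ σ)) := by
  have hm : 0 < min p q := lt_min hp hq
  refine tendsto_of_tendsto_of_tendsto_of_le_of_le' tendsto_const_nhds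
    ((tendsto_compCos hY h0).comp (tendsto_id.const_mul_atTop hm)) ?_ ?_
  · filter_upwards [eventually_gt_atTop 0] with t ht
    exact cosInf_le hY h0 (mul_pos hp ht) (mul_pos hq ht)
  · filter_upwards [eventually_gt_atTop 0] with t ht
    exact compCos_le hY h0 (mul_pos hm ht) (mul_le_mul_left (min_le_left _ _) _)
      (mul_pos hm ht) (mul_le_mul_left (min_le_right _ _) _)

/-- The asymptotic comparison angle depends only on the ideal endpoints. -/
theorem cosInf_congr (hY : IsHadamard Y) {ρ σ ρ' σ' : GeodesicRay Y} (h0 : ρ.1 0 = σ.1 0)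
    (h0' : ρ'.1 0 = σ'.1 0) (hρ : Asymptotic ρ ρ') (hσ : Asymptotic σ σ') :
    cosInf ρ σ = cosInf ρ' σ' := by
  obtain ⟨M, hM⟩ := hρ
  obtain ⟨N, hN⟩ := hσ
  refine tendsto_nhds_unique (tendsto_compCos hY h0) ?_
  have h := tendsto_compCos hY h0'
  have hz : Tendsto (fun t : ℝ≥0 => compCos ρ σ t t - compCos ρ' σ' t t) atTop (𝓝 0) := by
    have hb : Tendsto (fun t : ℝ≥0 => 2 * (M + N) / (t : ℝ)) atTop (𝓝 0) :=
      (NNReal.tendsto_coe_atTop.2 tendsto_id).const_div_atTop _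
    refine squeeze_zero_norm' ?_ hb
    filter_upwards [eventually_gt_atTop 0] with t ht
    have a1 : (0 : ℝ) < t := ht
    have e1 := abs_le.1 ((dist_dist_dist_le (ρ.1 t) (σ.1 t) (ρ'.1 t) (σ'.1 t)).trans
      (add_le_add (hM t) (hN t)))
    have e2 : dist (ρ.1 t) (σ.1 t) ≤ 2 * t := by
      have := dist_triangle_left (ρ.1 t) (σ.1 t) (ρ.1 0)
      rw [ρ.dist_zero, h0, σ.dist_zero] at this
      linarith
    have e3 : dist (ρ'.1 t) (σ'.1 t) ≤ 2 * t := by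
      have := dist_triangle_left (ρ'.1 t) (σ'.1 t) (ρ'.1 0)
      rw [ρ'.dist_zero, h0', σ'.dist_zero] at this
      linarith
    have e4 := dist_nonneg (x := ρ.1 t) (y := σ.1 t)
    have e5 := dist_nonneg (x := ρ'.1 t) (y := σ'.1 t)
    have e6 : compCos ρ σ t t - compCos ρ' σ' t t
        = (dist (ρ'.1 t) (σ'.1 t) - dist (ρ.1 t) (σ.1 t)) *
          (dist (ρ'.1 t) (σ'.1 t) + dist (ρ.1 t) (σ.1 t)) / (2 * t * t) := by
      rw [compCos, compCos, ← sub_div]; congr 1; ring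
    rw [e6, Real.norm_eq_abs, abs_div, abs_mul, abs_of_nonneg (by linarith : (0 : ℝ) ≤
      dist (ρ'.1 t) (σ'.1 t) + dist (ρ.1 t) (σ.1 t)),
      abs_of_pos (by positivity : (0 : ℝ) < 2 * t * t),
      div_le_div_iff₀ (by positivity) a1]
    have e7 : |dist (ρ'.1 t) (σ'.1 t) - dist (ρ.1 t) (σ.1 t)| ≤ M + N :=
      abs_le.2 ⟨by linarith, by linarith⟩
    have e8 := mul_le_mul e7 (by linarith : dist (ρ'.1 t) (σ'.1 t) + dist (ρ.1 t) (σ.1 t) ≤ 4 * t)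
      (by linarith) ((abs_nonneg _).trans e7)
    nlinarith
  have := h.add hz
  simpa using this

/-- The values of the Busemann functions of two asymptotic rays, each taken at the initial point of
the other ray, add up to at most zero. -/
theorem eventually_dist_add_dist_le (hY : IsHadamard Y) {σ τ : GeodesicRay Y}
    (h : Asymptotic σ τ) {ε : ℝ} (hε : 0 < ε) :
    ∀ᶠ T : ℝ≥0 in atTop, dist (τ.1 0) (σ.1 T) + dist (σ.1 0) (τ.1 T) ≤ 2 * T + ε := by
  set D := dist (σ.1 0) (τ.1 0) with hD
  filter_upwards [(NNReal.tendsto_coe_atTop.2 tendsto_id).eventually_ge_atTop (D ^ 2 / ε)]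
    with T hT
  rw [id, div_le_iff₀ hε] at hT
  have h1 := hY.quadrilateral (σ.1 0) (τ.1 0) (τ.1 T) (σ.1 T)
  have h2 := dist_le_of_asymptotic hY h T
  rw [τ.dist_zero, dist_comm (σ.1 T) (σ.1 0), σ.dist_zero, dist_comm (τ.1 T) (σ.1 T), ← hD] at h1
  have h3 : dist (σ.1 T) (τ.1 T) ^ 2 ≤ D ^ 2 := by gcongr
  have hT0 : (0 : ℝ) ≤ T := T.2
  refine le_of_sq_le_sq ?_ (by linarith)
  nlinarith [sq_nonneg (dist (τ.1 0) (σ.1 T) - dist (σ.1 0) (τ.1 T))]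

/-- The ray that runs along `ρ` from the point at time `a` on. -/
def shift (ρ : GeodesicRay Y) (a : ℝ≥0) : GeodesicRay Y :=
  ⟨fun t => ρ.1 (a + t), Isometry.of_dist_eq fun s t => by
    rw [ρ.2.dist_eq, NNReal.dist_eq, NNReal.dist_eq]; push_cast; congr 1; ring⟩

theorem shift_asymptotic (ρ : GeodesicRay Y) (a : ℝ≥0) : Asymptotic (ρ.shift a) ρ :=
  ⟨a, fun t => by
    change dist (ρ.1 (a + t)) (ρ.1 t) ≤ a
    rw [ρ.dist_eq]; push_cast; simp⟩

/-- Seen from the point `ρ a`, all comparison angles between `ρ` and a ray asymptotic to `σ` are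
at least the comparison angle of `ρ` and `σ` at the initial point at time `a`. This expresses the
convexity along `ρ` of the Busemann function of `σ`. -/
theorem compCos_shift_le (hY : IsHadamard Y) {ρ σ τ : GeodesicRay Y} (h0 : ρ.1 0 = σ.1 0)
    {a : ℝ≥0} (ha : 0 < a) (hτ : Asymptotic σ τ) (hτ0 : τ.1 0 = ρ.1 a) {r t : ℝ≥0} (hr : 0 < r)
    (ht : 0 < t) : compCos (ρ.shift a) τ r t ≤ compCos ρ σ a a := by
  set c := compCos ρ σ a a with hc
  have hc1 := abs_le.1 (abs_compCos_le h0 ha ha)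
  rw [← hc] at hc1
  have ha' : (0 : ℝ) < a := ha
  have ht' : (0 : ℝ) < t := ht
  have hsh0 : (ρ.shift a).1 0 = τ.1 0 := by
    rw [hτ0]; change ρ.1 (a + 0) = _; rw [add_zero]
  -- the Busemann function of `τ` at `ρ (a + r)` is at least `-r * c`
  have key : ∀ r : ℝ≥0, 0 < r → (t : ℝ) - r * c ≤ dist (ρ.1 (a + r)) (τ.1 t) := by
    intro r hr
    have hr' : (0 : ℝ) < r := hr
    refine le_of_forall_pos_le_add fun ε hε => ?_
    obtain ⟨T, hT1, hT2, hT3⟩ := ((eventually_dist_add_dist_le hY hτ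
      (show 0 < ε * a / r by positivity)).and
      ((eventually_ge_atTop a).and (eventually_ge_atTop t))).exists
    have haT : (a : ℝ) ≤ T := hT2
    have htT : (t : ℝ) ≤ T := hT3
    have e1 : (T : ℝ) - a * c ≤ dist (ρ.1 a) (σ.1 T) := by
      refine le_of_sq_le_sq ?_ dist_nonneg
      rw [dist_sq_eq ρ σ ha (ha.trans_le hT2)]
      have := compCos_le hY h0 ha le_rfl ha hT2
      rw [← hc] at this
      have h2 : (a : ℝ) * T * compCos ρ σ a T ≤ a * T * c := by gcongr
      have h3 : (a : ℝ) ^ 2 * c ^ 2 ≤ a ^ 2 * 1 := by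
        gcongr
        nlinarith
      nlinarith
    rw [hτ0] at hT1
    have e2 : dist (σ.1 0) (τ.1 T) ≤ T + a * c + ε * a / r := by linarith
    have h01 : (a / (a + r : ℝ≥0) : ℝ) ∈ Icc (0 : ℝ) 1 := by
      push_cast
      exact ⟨by positivity, by rw [div_le_one (by positivity)]; linarith⟩
    have e3 := hY.dist_seg_le (ρ.1 0) (ρ.1 (a + r)) (τ.1 T) h01
    rw [← eq_seg hY ρ le_self_add (by positivity), ← hτ0, τ.dist_zero, h0] at e3
    push_cast at e3
    have e4 : (1 - a / (a + r) : ℝ) = r / (a + r) := by field_simp; ring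
    rw [e4, div_mul_eq_mul_div, div_mul_eq_mul_div, ← add_div, le_div_iff₀ (by positivity)] at e3
    have e5 : (r : ℝ) * dist (σ.1 0) (τ.1 T) ≤ r * (T + a * c + ε * a / r) := by gcongr
    have e6 : (r : ℝ) * (T + a * c + ε * a / r) = r * T + r * a * c + ε * a := by field_simp
    have e7 : (a : ℝ) * (T - r * c) ≤ a * (dist (ρ.1 (a + r)) (τ.1 T) + ε) := by linarith
    have e8 := le_of_mul_le_mul_left e7 ha'
    have e9 := dist_triangle (ρ.1 (a + r)) (τ.1 t) (τ.1 T)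
    rw [τ.dist_eq, abs_sub_comm, abs_of_nonneg (by linarith)] at e9
    linarith
  have key2 : ∀ r' : ℝ≥0, 0 < r' → r' ≤ r → r' ≤ t →
      compCos (ρ.shift a) τ r t ≤ c + r' / (2 * t) := by
    intro r' hr' hrr hrt
    have a1 : (0 : ℝ) < r' := hr'
    have a2 : (r' : ℝ) ≤ t := hrt
    refine (compCos_le_left hY hsh0 hr' hrr ht).trans ?_
    have e1 := key r' hr'
    rw [compCos]
    change ((r' : ℝ) ^ 2 + (t : ℝ) ^ 2 - dist (ρ.1 (a + r')) (τ.1 t) ^ 2) / (2 * r' * t) ≤ _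
    rw [div_le_iff₀ (by positivity)]
    have e2 : (0 : ℝ) ≤ t - r' * c := by nlinarith
    have e3 : ((t : ℝ) - r' * c) ^ 2 ≤ dist (ρ.1 (a + r')) (τ.1 t) ^ 2 := by gcongr
    have e4 : (c + r' / (2 * t)) * (2 * r' * t) = 2 * r' * t * c + r' ^ 2 := by
      field_simp
    rw [e4]
    nlinarith [sq_nonneg ((r' : ℝ) * c)]
  have hlim : Tendsto (fun r' : ℝ≥0 => c + (r' : ℝ) / (2 * t)) (𝓝[>] 0)
      (𝓝 (c + (0 : ℝ≥0) / (2 * t))) :=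
    ((by fun_prop : Continuous fun r' : ℝ≥0 => c + (r' : ℝ) / (2 * t)).tendsto 0).mono_left
      nhdsWithin_le_nhds
  have := ge_of_tendsto hlim (by
    filter_upwards [Ioc_mem_nhdsGT hr, Ioc_mem_nhdsGT ht] with r' h1 h2
    exact key2 r' h1.1 h1.2 h2.2)
  simpa using this

end GeodesicRay

open GeodesicRay

theorem comparisonAngle_mem (p x y : Y) : comparisonAngle p x y ∈ Icc 0 Real.pi :=
  ⟨Real.arccos_nonneg _, Real.arccos_le_pi _⟩

theorem rayAngle_le {ρ σ : GeodesicRay Y} (h0 : ρ.1 0 = σ.1 0) {c : ℝ}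
    (h : ∀ s t : ℝ≥0, 0 < s → 0 < t → c ≤ compCos ρ σ s t) : rayAngle ρ σ ≤ Real.arccos c := by
  refine limsup_le_of_le ?_ ?_
  · exact (isBoundedUnder_of ⟨0, fun _ => (comparisonAngle_mem _ _ _).1⟩).isCoboundedUnder_le
  · filter_upwards [prod_mem_prod self_mem_nhdsWithin self_mem_nhdsWithin] with q hq
    rw [comparisonAngle_eq h0]
    exact Real.arccos_le_arccos (h _ _ hq.1 hq.2)

theorem le_rayAngle {ρ σ : GeodesicRay Y} (h0 : ρ.1 0 = σ.1 0) {c : ℝ}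
    (h : ∀ s t : ℝ≥0, 0 < s → 0 < t → compCos ρ σ s t ≤ c) : Real.arccos c ≤ rayAngle ρ σ := by
  refine le_limsup_of_frequently_le (Eventually.frequently ?_) ?_
  · filter_upwards [prod_mem_prod self_mem_nhdsWithin self_mem_nhdsWithin] with q hq
    rw [comparisonAngle_eq h0]
    exact Real.arccos_le_arccos (h _ _ hq.1 hq.2)
  · exact isBoundedUnder_of ⟨Real.pi, fun _ => (comparisonAngle_mem _ _ _).2⟩

/-- The Tits angle of the endpoints of two rays with the same initial point is their asymptotic
comparison angle; it is approached by the angles at the points of one of the rays. -/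
theorem titsAngle_eq [ProperSpace Y] (hY : IsHadamard Y) {ρ σ : GeodesicRay Y}
    (h0 : ρ.1 0 = σ.1 0) : titsAngle ρ.endpoint σ.endpoint = Real.arccos (cosInf ρ σ) := by
  have hle : ∀ θ ∈ {θ : ℝ | ∃ ρ' σ' : GeodesicRay Y, ρ'.1 0 = σ'.1 0 ∧ ρ'.endpoint = ρ.endpoint ∧
      σ'.endpoint = σ.endpoint ∧ θ = rayAngle ρ' σ'}, θ ≤ Real.arccos (cosInf ρ σ) := by
    rintro _ ⟨ρ', σ', h0', hρ, hσ, rfl⟩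
    refine rayAngle_le h0' fun s t hs ht => ?_
    rw [← cosInf_congr hY h0' h0 (endpoint_eq_iff.1 hρ) (endpoint_eq_iff.1 hσ)]
    exact cosInf_le hY h0' hs ht
  refine le_antisymm (csSup_le ⟨_, ρ, σ, h0, rfl, rfl, rfl⟩ hle) ?_
  have hcont := (Real.continuous_arccos.tendsto _).comp (tendsto_compCos hY h0)
  refine le_of_tendsto hcont ?_
  filter_upwards [eventually_gt_atTop 0] with a ha
  obtain ⟨τ, hτ0, hτ⟩ := hY.exists_asymptotic (ρ.1 a) σ
  have hsh0 : (ρ.shift a).1 0 = τ.1 0 := by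
    rw [hτ0]; change ρ.1 (a + 0) = _; rw [add_zero]
  refine (le_rayAngle hsh0 fun s t hs ht => compCos_shift_le hY h0 ha
    (endpoint_eq_iff.1 (endpoint_eq_iff.2 hτ).symm) hτ0 hs ht).trans ?_
  exact le_csSup ⟨_, hle⟩ ⟨_, _, hsh0, endpoint_eq_iff.2 (ρ.shift_asymptotic a),
    endpoint_eq_iff.2 hτ, rfl⟩

end Tits

/-! ### Half-spaces in spaces with midpoints -/

section HalfSpace

variable {X : Type*} [MetricSpace X] {E : Type*} [NormedAddCommGroup E] [InnerProductSpace ℝ E]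

/-- In a metric space with midpoints that satisfy the Bruhat–Tits inequality, an isometrically
embedded inner product space `f` and a ray `g` from its origin that is at right angles to it, in
the sense of `hfg`, span an isometrically embedded half-space. Its points `F v h` are the midpoints
of `f (2 v)` and `g (2 h)`. -/
theorem exists_halfSpace
    (hmid : ∀ a b : X, ∃ m : X, ∀ p : X,
      dist p m ^ 2 ≤ 1 / 2 * dist p a ^ 2 + 1 / 2 * dist p b ^ 2 - 1 / 4 * dist a b ^ 2)
    {f : E → X} (hf : ∀ v w, dist (f v) (f w) = ‖v - w‖) {g : ℝ → X}
    (hg : ∀ h h' : ℝ, 0 ≤ h → 0 ≤ h' → dist (g h) (g h') = |h - h'|)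
    (hfg : ∀ (h : ℝ) (v : E), 0 ≤ h → dist (g h) (f v) ^ 2 = h ^ 2 + ‖v‖ ^ 2) :
    ∃ F : E → ℝ → X, (∀ v, F v 0 = f v) ∧ ∀ (v v' : E) (h h' : ℝ), 0 ≤ h → 0 ≤ h' →
      dist (F v h) (F v' h') ^ 2 = ‖v - v'‖ ^ 2 + (h - h') ^ 2 := by
  choose mid hm using hmid
  set F : E → ℝ → X := fun v h => mid (f ((2 : ℝ) • v)) (g (2 * h))
  -- the Bruhat–Tits inequality for the points `F v h`
  have hCN : ∀ (v : E) (h : ℝ), 0 ≤ h → ∀ p, dist p (F v h) ^ 2 ≤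
      1 / 2 * dist p (f ((2 : ℝ) • v)) ^ 2 + 1 / 2 * dist p (g (2 * h)) ^ 2
        - (‖v‖ ^ 2 + h ^ 2) := by
    intro v h hh p
    have h1 := hm (f ((2 : ℝ) • v)) (g (2 * h)) p
    have h2 := hfg (2 * h) ((2 : ℝ) • v) (by linarith)
    rw [norm_smul, Real.norm_of_nonneg (by norm_num : (0 : ℝ) ≤ 2), dist_comm] at h2
    rw [h2] at h1
    calc _ ≤ _ := h1
      _ = _ := by ring
  have hid1 : ∀ v w : E, ‖w - (2 : ℝ) • v‖ ^ 2 = 2 * ‖v - w‖ ^ 2 + 2 * ‖v‖ ^ 2 - ‖w‖ ^ 2 := by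
    intro v w
    rw [norm_sub_sq_real, norm_sub_sq_real, norm_smul, inner_smul_right, real_inner_comm,
      Real.norm_of_nonneg (by norm_num : (0 : ℝ) ≤ 2)]
    ring
  have hup1 : ∀ (v w : E) (h : ℝ), 0 ≤ h → dist (f w) (F v h) ^ 2 ≤ ‖v - w‖ ^ 2 + h ^ 2 := by
    intro v w h hh
    have h1 := hCN v h hh (f w)
    have h2 := hfg (2 * h) w (by linarith)
    rw [hf, hid1, dist_comm (f w) (g _), h2] at h1
    linarith
  have hup2 : ∀ (v : E) (n h : ℝ), 0 ≤ h → 0 ≤ n →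
      dist (g n) (F v h) ^ 2 ≤ ‖v‖ ^ 2 + (n - h) ^ 2 := by
    intro v n h hh hn
    have h1 := hCN v h hh (g n)
    rw [hfg n _ hn, hg n _ hn (by linarith), norm_smul,
      Real.norm_of_nonneg (by norm_num : (0 : ℝ) ≤ 2), sq_abs] at h1
    linarith
  -- `F v h` is not closer to `f v` than `h`, as seen from far away on the ray `g`
  have hlow1 : ∀ (v : E) (h : ℝ), 0 ≤ h → h ≤ dist (f v) (F v h) := by
    intro v h hh
    refine le_of_forall_pos_le_add fun ε hε => ?_
    set k : ℝ := ‖v‖ ^ 2 / (2 * ε) + 1 with hk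
    have hk0 : 0 < k := by positivity
    have h1 : dist (g (h + k)) (F v h) ≤ k + ε := by
      refine le_of_sq_le_sq ?_ (by linarith)
      have h2 := hup2 v (h + k) h hh (by linarith)
      have h3 : 2 * ε * k = ‖v‖ ^ 2 + 2 * ε := by rw [hk]; field_simp
      nlinarith
    have h2 : h + k ≤ dist (g (h + k)) (f v) := by
      refine le_of_sq_le_sq ?_ dist_nonneg
      rw [hfg _ _ (by linarith)]
      nlinarith [sq_nonneg ‖v‖]
    have h3 := dist_triangle_right (g (h + k)) (f v) (F v h)
    linarith
  have hF0 : ∀ v : E, F v 0 = f v := by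
    intro v
    have h1 := hup1 v v 0 le_rfl
    rw [sub_self, norm_zero] at h1
    have h2 : dist (f v) (F v 0) ^ 2 ≤ 0 := by linarith
    exact (dist_eq_zero.1 (pow_eq_zero_iff two_ne_zero |>.1 (le_antisymm h2 (sq_nonneg _)))).symm
  -- the distances from the boundary are exact, as `f v` is the midpoint of `f w` and `f (2 v - w)`
  have hex : ∀ (v w : E) (h : ℝ), 0 ≤ h → dist (f w) (F v h) ^ 2 = ‖v - w‖ ^ 2 + h ^ 2 := by
    intro v w h hh
    refine (hup1 v w h hh).antisymm ?_
    have h1 := hup1 v ((2 : ℝ) • v - w) h hh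
    have h2 := hm (f w) (f ((2 : ℝ) • v - w)) (f v)
    have n1 : v - ((2 : ℝ) • v - w) = -(v - w) := by rw [two_smul]; abel
    have n2 : w - ((2 : ℝ) • v - w) = -((2 : ℝ) • (v - w)) := by
      rw [smul_sub, two_smul, two_smul]; abel
    rw [hf, hf, hf, n1, n2, norm_neg, norm_neg, norm_smul,
      Real.norm_of_nonneg (by norm_num : (0 : ℝ) ≤ 2)] at h2
    have h3 : dist (f v) (mid (f w) (f ((2 : ℝ) • v - w))) ^ 2 ≤ 0 := by linarith
    have h4 : f v = mid (f w) (f ((2 : ℝ) • v - w)) :=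
      dist_eq_zero.1 (pow_eq_zero_iff two_ne_zero |>.1 (le_antisymm h3 (sq_nonneg _)))
    have h5 := hm (f w) (f ((2 : ℝ) • v - w)) (F v h)
    rw [← h4, hf, n2, norm_neg, norm_smul, Real.norm_of_nonneg (by norm_num : (0 : ℝ) ≤ 2),
      dist_comm _ (f v), dist_comm _ (f w), dist_comm _ (f ((2 : ℝ) • v - w))] at h5
    have h6 : h ^ 2 ≤ dist (f v) (F v h) ^ 2 := by gcongr; exact hlow1 v h hh
    rw [n1, norm_neg] at h1
    linarith
  have hup : ∀ (v v' : E) (h h' : ℝ), 0 ≤ h → 0 ≤ h' →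
      dist (F v h) (F v' h') ^ 2 ≤ ‖v - v'‖ ^ 2 + (h - h') ^ 2 := by
    intro v v' h h' hh hh'
    have h1 := hCN v' h' hh' (F v h)
    have h2 := hup2 v (2 * h') h hh (by linarith)
    have h3 := hex v ((2 : ℝ) • v') h hh
    rw [hid1] at h3
    rw [dist_comm _ (f _), dist_comm _ (g _), h3, norm_sub_rev v' v] at h1
    linarith
  -- for `h < h'` the line through the two points meets the boundary, at a point from which both
  -- distances are known
  have hlow : ∀ (v v' : E) (h h' : ℝ), 0 ≤ h → h < h' →
      √(‖v - v'‖ ^ 2 + (h - h') ^ 2) ≤ dist (F v h) (F v' h') := by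
    intro v v' h h' hh hh'
    have hd : 0 < h' - h := by linarith
    set l : ℝ := h / (h' - h) with hl
    have hl0 : 0 ≤ l := by positivity
    set w : E := v + l • (v - v') with hw
    have n1 : v - w = -(l • (v - v')) := by rw [hw]; abel
    have n2 : v' - w = -((1 + l) • (v - v')) := by rw [hw, add_smul, one_smul]; abel
    have h1 := hex v w h hh
    have h2 := hex v' w h' (by linarith)
    rw [n1, norm_neg, norm_smul, Real.norm_of_nonneg hl0] at h1
    rw [n2, norm_neg, norm_smul, Real.norm_of_nonneg (by linarith)] at h2
    set S := √(‖v - v'‖ ^ 2 + (h - h') ^ 2) with hS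
    have hS2 : S ^ 2 = ‖v - v'‖ ^ 2 + (h - h') ^ 2 := Real.sq_sqrt (by positivity)
    have hS0 : 0 ≤ S := Real.sqrt_nonneg _
    have e1 : h = l * (h' - h) := by rw [hl]; field_simp
    have e2 : h' = (1 + l) * (h' - h) := by linarith
    have h3 : dist (f w) (F v h) = l * S := by
      refine (pow_left_inj₀ dist_nonneg (by positivity) two_ne_zero).1 ?_
      rw [h1, mul_pow l S, hS2]
      nth_rewrite 1 [e1]
      ring
    have h4 : dist (f w) (F v' h') = (1 + l) * S := by
      refine (pow_left_inj₀ dist_nonneg (by positivity) two_ne_zero).1 ?_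
      rw [h2, mul_pow (1 + l) S, hS2]
      nth_rewrite 1 [e2]
      ring
    have h5 := dist_triangle (f w) (F v h) (F v' h')
    linarith
  have hlow' : ∀ (v v' : E) (h h' : ℝ), 0 ≤ h → h ≤ h' →
      √(‖v - v'‖ ^ 2 + (h - h') ^ 2) ≤ dist (F v h) (F v' h') := by
    intro v v' h h' hh hh'
    rcases eq_or_lt_of_le hh' with rfl | hlt
    · refine le_of_forall_pos_le_add fun ε hε => ?_
      have h1 := hlow v v' h (h + ε) hh (by linarith)
      have h2 : dist (F v' h) (F v' (h + ε)) ≤ ε := by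
        refine le_of_sq_le_sq ?_ hε.le
        refine (hup v' v' h (h + ε) hh (by linarith)).trans (le_of_eq ?_)
        rw [sub_self, norm_zero]; ring
      have h3 : √(‖v - v'‖ ^ 2 + (h - h) ^ 2) ≤ √(‖v - v'‖ ^ 2 + (h - (h + ε)) ^ 2) := by
        apply Real.sqrt_le_sqrt
        nlinarith [sq_nonneg ε]
      linarith [dist_triangle (F v h) (F v' h) (F v' (h + ε))]
    · exact hlow v v' h h' hh hlt
  refine ⟨F, hF0, fun v v' h h' hh hh' => (hup v v' h h' hh hh').antisymm ?_⟩
  rcases le_total h h' with hle | hle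
  · exact (Real.sqrt_le_left dist_nonneg).1 (hlow' v v' h h' hh hle)
  · have := (Real.sqrt_le_left dist_nonneg).1 (hlow' v' v h' h hh' hle)
    rw [norm_sub_rev, dist_comm] at this
    linarith

end HalfSpace

/-! ### The cone at infinity -/

section Cone

variable {Y : Type u} [MetricSpace Y]

/-- The cone at infinity with base point `o`, the Euclidean cone over the ideal boundary: its
points are the geodesic rays of constant speed issuing from `o`. Speed zero is the apex. -/
def InfinityCone (o : Y) : Type u :=
  {a : ℝ≥0 → Y // a 0 = o ∧ ∃ v : ℝ≥0, ∀ s t, dist (a s) (a t) = v * |(s : ℝ) - t|}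

namespace InfinityCone

variable {o : Y}

theorem eq_seg (hY : IsHadamard Y) (a : InfinityCone o) {s t : ℝ≥0} (hst : s ≤ t) (ht : 0 < t) :
    a.1 s = hY.seg o (a.1 t) (s / t) := by
  obtain ⟨a, rfl, v, hv⟩ := a
  have ht' : (0 : ℝ) < t := ht
  have hst' : (s : ℝ) ≤ t := hst
  have h01 : (s / t : ℝ) ∈ Icc (0 : ℝ) 1 := ⟨by positivity, by rw [div_le_one ht']; exact hst'⟩
  apply hY.eq_seg h01
  · simp only [hv, NNReal.coe_zero, zero_sub, abs_neg, NNReal.abs_eq]; field_simp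
  · simp only [hv, NNReal.coe_zero, zero_sub, abs_neg, NNReal.abs_eq]
    rw [abs_sub_comm, abs_of_nonneg (by linarith)]; field_simp

/-- The distance in the cone, the asymptotic growth rate of the distance. It is a supremum, to
which the time `t = 0` contributes `0`. -/
noncomputable def coneDist (a b : InfinityCone o) : ℝ :=
  ⨆ t : ℝ≥0, dist (a.1 t) (b.1 t) / t

theorem monotone_dist_div (hY : IsHadamard Y) (a b : InfinityCone o) :
    Monotone fun t : ℝ≥0 => dist (a.1 t) (b.1 t) / (t : ℝ) := by
  intro s t hst
  rcases eq_or_lt_of_le (zero_le (a := s)) with rfl | hs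
  · simp only [NNReal.coe_zero, div_zero]; positivity
  have ht : 0 < t := hs.trans_le hst
  have hs' : (0 : ℝ) < s := hs
  have ht' : (0 : ℝ) < t := ht
  have hst' : (s : ℝ) ≤ t := hst
  have h01 : (s / t : ℝ) ∈ Icc (0 : ℝ) 1 := ⟨by positivity, by rw [div_le_one ht']; exact hst'⟩
  have h := hY.dist_seg_left_le o (a.1 t) (b.1 t) h01
  rw [← eq_seg hY a hst ht, ← eq_seg hY b hst ht] at h
  change dist (a.1 s) (b.1 s) / (s : ℝ) ≤ dist (a.1 t) (b.1 t) / (t : ℝ)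
  rw [div_le_iff₀ hs']
  calc _ ≤ _ := h
    _ = _ := by ring

theorem exists_dist_base (a : InfinityCone o) : ∃ v : ℝ≥0, ∀ t, dist o (a.1 t) = v * t := by
  obtain ⟨a, rfl, v, hv⟩ := a
  exact ⟨v, fun t => by simp [hv]⟩

theorem bddAbove_dist_div (a b : InfinityCone o) :
    BddAbove (range fun t : ℝ≥0 => dist (a.1 t) (b.1 t) / (t : ℝ)) := by
  obtain ⟨v, hv⟩ := a.exists_dist_base
  obtain ⟨w, hw⟩ := b.exists_dist_base
  refine ⟨v + w, ?_⟩
  rintro _ ⟨t, rfl⟩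
  refine div_le_of_le_mul₀ t.2 (by positivity) ?_
  have := dist_triangle_left (a.1 t) (b.1 t) o
  rw [hv, hw] at this
  linarith

theorem dist_div_le_coneDist (a b : InfinityCone o) (t : ℝ≥0) :
    dist (a.1 t) (b.1 t) / t ≤ coneDist a b :=
  le_ciSup (bddAbove_dist_div a b) t

theorem tendsto_coneDist (hY : IsHadamard Y) (a b : InfinityCone o) :
    Tendsto (fun t : ℝ≥0 => dist (a.1 t) (b.1 t) / (t : ℝ)) atTop (𝓝 (coneDist a b)) :=
  tendsto_atTop_ciSup (monotone_dist_div hY a b) (bddAbove_dist_div a b)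

/-- The metric of the cone at infinity. -/
noncomputable abbrev metricSpace (hY : IsHadamard Y) (o : Y) : MetricSpace (InfinityCone o) where
  dist := coneDist
  dist_self a := by simp [coneDist]
  dist_comm a b := by simp only [coneDist, dist_comm]
  dist_triangle a b c := by
    refine le_of_tendsto_of_tendsto' (tendsto_coneDist hY a c)
      ((tendsto_coneDist hY a b).add (tendsto_coneDist hY b c)) fun t => ?_
    rw [← add_div]
    exact div_le_div_of_nonneg_right (dist_triangle _ _ _) t.2
  eq_of_dist_eq_zero {a b} h := by
    refine Subtype.ext (funext fun t => ?_)
    rcases eq_or_lt_of_le (zero_le (a := t)) with rfl | ht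
    · rw [a.2.1, b.2.1]
    · have ht' : (0 : ℝ) < t := ht
      have h1 := (dist_div_le_coneDist a b t).trans h.le
      rw [div_le_iff₀ ht', zero_mul] at h1
      exact dist_le_zero.1 h1

/-- Midpoints in the cone are limits of the segments from `o` to the midpoints of `a n` and
`b n`. -/
theorem exists_midpoint [ProperSpace Y] (hY : IsHadamard Y) (a b : InfinityCone o) :
    ∃ m : InfinityCone o, ∀ p : InfinityCone o, coneDist p m ^ 2 ≤
      1 / 2 * coneDist p a ^ 2 + 1 / 2 * coneDist p b ^ 2 - 1 / 4 * coneDist a b ^ 2 := by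
  obtain ⟨v, hv⟩ := a.exists_dist_base
  obtain ⟨w, hw⟩ := b.exists_dist_base
  set U : Ultrafilter ℕ := hyperfilter ℕ
  have hUle : (U : Filter ℕ) ≤ atTop := Nat.hyperfilter_le_atTop
  have hcast : Tendsto (fun n : ℕ => (n : ℝ≥0)) U atTop :=
    tendsto_natCast_atTop_atTop.mono_left hUle
  have ht2 : (1 / 2 : ℝ) ∈ Icc (0 : ℝ) 1 := by norm_num
  set q : ℕ → Y := fun n => hY.seg (a.1 n) (b.1 n) (1 / 2)
  have hqo : ∀ n, dist o (q n) ≤ (v + w) * n := by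
    intro n
    have h := hY.dist_seg_le (a.1 n) (b.1 n) o ht2
    rw [dist_comm _ o, dist_comm _ o, dist_comm _ o, hv, hw, NNReal.coe_natCast] at h
    have h1 : (0 : ℝ) ≤ v * n := by positivity
    have h2 : (0 : ℝ) ≤ w * n := by positivity
    linarith
  have h01 : ∀ t : ℝ≥0, ∀ᶠ n : ℕ in (U : Filter ℕ),
      (0 : ℝ) < n ∧ (t / n : ℝ) ∈ Icc (0 : ℝ) 1 := by
    intro t
    filter_upwards [hUle (tendsto_natCast_atTop_atTop.eventually_ge_atTop (t : ℝ)),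
      hUle (eventually_gt_atTop 0)] with n h1 h2
    have h2' : (0 : ℝ) < n := by exact_mod_cast h2
    exact ⟨h2', by positivity, by rw [div_le_one h2']; exact h1⟩
  have hspeed : ∃ c : ℝ, 0 ≤ c ∧ Tendsto (fun n => dist o (q n) / n) U (𝓝 c) := by
    obtain ⟨c, hc, hlim⟩ := (isCompact_Icc (a := (0 : ℝ)) (b := v + w)).ultrafilter_le_nhds
      (U.map fun n => dist o (q n) / n) (by
        rw [le_principal_iff]
        change ∀ᶠ n in (U : Filter ℕ), _
        filter_upwards [h01 0] with n hn
        exact ⟨by positivity, by rw [div_le_iff₀ hn.1]; exact hqo n⟩)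
    exact ⟨c, hc.1, hlim⟩
  obtain ⟨c, hc0, hc⟩ := hspeed
  have hex : ∀ t : ℝ≥0, ∃ y, Tendsto (fun n : ℕ => hY.seg o (q n) (t / n)) U (𝓝 y) := by
    intro t
    obtain ⟨y, -, hy⟩ := (isCompact_closedBall o ((v + w) * t : ℝ)).ultrafilter_le_nhds
      (U.map fun n : ℕ => hY.seg o (q n) (t / n)) (by
        rw [le_principal_iff]
        change ∀ᶠ n in (U : Filter ℕ), _
        filter_upwards [h01 t] with n hn
        rw [Metric.mem_closedBall, dist_comm, hY.dist_left_seg _ _ hn.2]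
        have := mul_le_mul_of_nonneg_left (hqo n) hn.2.1
        refine this.trans (le_of_eq ?_)
        have := hn.1
        field_simp)
    exact ⟨y, hy⟩
  choose m hm using hex
  have hmdist : ∀ s t, dist (m s) (m t) = c * |(s : ℝ) - t| := by
    intro s t
    refine tendsto_nhds_unique ((hm s).dist (hm t)) ((hc.mul_const _).congr' ?_)
    filter_upwards [h01 s, h01 t] with n hs ht
    rw [hY.dist_seg_seg _ _ hs.2 ht.2, ← sub_div, abs_div, abs_of_pos hs.1]
    ring
  have hm0 : m 0 = o := by
    refine tendsto_nhds_unique (hm 0) (tendsto_const_nhds.congr fun n => ?_)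
    simp
  refine ⟨⟨m, hm0, ⟨c, hc0⟩, hmdist⟩, fun p => ?_⟩
  set R := 1 / 2 * coneDist p a ^ 2 + 1 / 2 * coneDist p b ^ 2 - 1 / 4 * coneDist a b ^ 2
  have hlim : Tendsto (fun n : ℕ => 1 / 2 * (dist (p.1 n) (a.1 n) / (n : ℝ)) ^ 2 +
      1 / 2 * (dist (p.1 n) (b.1 n) / (n : ℝ)) ^ 2 - 1 / 4 * (dist (a.1 n) (b.1 n) / (n : ℝ)) ^ 2)
      U (𝓝 R) := by
    have e : ∀ a b : InfinityCone o, Tendsto (fun n : ℕ => dist (a.1 n) (b.1 n) / (n : ℝ)) U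
        (𝓝 (coneDist a b)) := fun a b => by
      simpa [Function.comp_def] using (tendsto_coneDist hY a b).comp hcast
    exact ((((e p a).pow 2).const_mul _).add (((e p b).pow 2).const_mul _)).sub
      (((e a b).pow 2).const_mul _)
  have key : ∀ t : ℝ≥0, (dist (p.1 t) (m t) / t) ^ 2 ≤ R := by
    intro t
    have h1 : Tendsto (fun n : ℕ => (dist (p.1 t) (hY.seg o (q n) (t / n)) / t) ^ 2) U
        (𝓝 ((dist (p.1 t) (m t) / t) ^ 2)) :=
      ((tendsto_const_nhds.dist (hm t)).div_const _).pow 2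
    refine le_of_tendsto_of_tendsto h1 hlim ?_
    filter_upwards [h01 t] with n hn
    have hn0 := hn.1
    have e1 : dist (p.1 t) (hY.seg o (q n) (t / n)) / t ≤ dist (p.1 n) (q n) / n := by
      have e2 := hY.dist_seg_left_le o (p.1 n) (q n) hn.2
      have e3 := p.eq_seg hY (s := t) (t := n)
        (by have := hn.2.2; rw [div_le_one hn0] at this; exact_mod_cast this)
        (by exact_mod_cast hn0)
      rw [NNReal.coe_natCast] at e3
      rw [← e3] at e2
      refine div_le_of_le_mul₀ t.2 (by positivity) (e2.trans (le_of_eq (by ring)))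
    have e4 := hY.dist_seg_sq_le (a.1 n) (b.1 n) (p.1 n) ht2
    have e5 : (dist (p.1 n) (q n) / n) ^ 2 ≤ 1 / 2 * (dist (p.1 n) (a.1 n) / (n : ℝ)) ^ 2 +
      1 / 2 * (dist (p.1 n) (b.1 n) / (n : ℝ)) ^ 2
        - 1 / 4 * (dist (a.1 n) (b.1 n) / (n : ℝ)) ^ 2 := by
      simp only [div_pow]
      rw [div_le_iff₀ (by positivity)]
      refine e4.trans (le_of_eq ?_)
      field_simp
      ring
    refine le_trans ?_ e5
    gcongr
  have hR0 : 0 ≤ R := (sq_nonneg _).trans (key 0)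
  have h2 : coneDist p ⟨m, hm0, ⟨c, hc0⟩, hmdist⟩ ≤ √R :=
    ciSup_le fun t => Real.le_sqrt_of_sq_le (key t)
  have h3 : 0 ≤ coneDist p ⟨m, hm0, ⟨c, hc0⟩, hmdist⟩ := Real.iSup_nonneg fun t => by positivity
  calc _ ≤ (√R) ^ 2 := by gcongr
    _ = R := Real.sq_sqrt hR0

/-- The ray `ρ` run through with speed `r`. -/
def ofRay (ρ : GeodesicRay Y) (h : ρ.1 0 = o) (r : ℝ≥0) : InfinityCone o :=
  ⟨fun t => ρ.1 (r * t), by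
    change ρ.1 (r * 0) = o; rw [mul_zero]; exact h, r, fun s t => by
    rw [ρ.dist_eq]; push_cast; rw [← mul_sub, abs_mul, NNReal.abs_eq]⟩

/-- The law of cosines in the cone at infinity. -/
theorem coneDist_ofRay_sq (hY : IsHadamard Y) {ρ σ : GeodesicRay Y} (hρ : ρ.1 0 = o)
    (hσ : σ.1 0 = o) (r q : ℝ≥0) : coneDist (ofRay ρ hρ r) (ofRay σ hσ q) ^ 2
      = (r : ℝ) ^ 2 + (q : ℝ) ^ 2 - 2 * r * q * ρ.cosInf σ := by
  have h0 : ρ.1 0 = σ.1 0 := hρ.trans hσ.symm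
  refine tendsto_nhds_unique ((tendsto_coneDist hY _ _).pow 2) ?_
  rcases eq_or_lt_of_le (zero_le (a := r)) with rfl | hr
  · refine tendsto_const_nhds.congr' ?_
    filter_upwards [eventually_gt_atTop 0] with t ht
    have ht' : (0 : ℝ) < t := ht
    change _ = (dist (ρ.1 (0 * t)) (σ.1 (q * t)) / (t : ℝ)) ^ 2
    rw [zero_mul, h0, σ.dist_zero]
    push_cast
    field_simp
    ring
  rcases eq_or_lt_of_le (zero_le (a := q)) with rfl | hq
  · refine tendsto_const_nhds.congr' ?_
    filter_upwards [eventually_gt_atTop 0] with t ht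
    have ht' : (0 : ℝ) < t := ht
    change _ = (dist (ρ.1 (r * t)) (σ.1 (0 * t)) / (t : ℝ)) ^ 2
    rw [zero_mul, ← h0, dist_comm, ρ.dist_zero]
    push_cast
    field_simp
    ring
  refine (((GeodesicRay.tendsto_compCos_mul hY h0 hr hq).const_mul (2 * r * q : ℝ)).const_sub
    ((r : ℝ) ^ 2 + (q : ℝ) ^ 2)).congr' ?_
  filter_upwards [eventually_gt_atTop 0] with t ht
  have ht' : (0 : ℝ) < t := ht
  change _ = (dist (ρ.1 (r * t)) (σ.1 (q * t)) / (t : ℝ)) ^ 2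
  rw [div_pow, GeodesicRay.dist_sq_eq ρ σ (mul_pos hr ht) (mul_pos hq ht)]
  push_cast
  field_simp

/-- The points of the cone at distance one from the apex are the rays of unit speed. -/
theorem exists_eq_ofRay {a b : InfinityCone o} (hb : ∀ t, b.1 t = o) (h : coneDist a b = 1) :
    ∃ (ρ : GeodesicRay Y) (hρ : ρ.1 0 = o), a = ofRay ρ hρ 1 := by
  obtain ⟨a, rfl, v, hv⟩ := a
  have hd : ∀ t : ℝ≥0, dist (a t) (b.1 t) = v * t := fun t => by rw [hb, hv]; simp
  have hv1 : (v : ℝ) = 1 := by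
    refine Eq.trans (le_antisymm ?_ (ciSup_le fun t => ?_)) h
    · refine le_trans (le_of_eq ?_) (dist_div_le_coneDist _ _ 1)
      simp [hd]
    · simp only [hd]
      exact div_le_of_le_mul₀ t.2 v.2 le_rfl
  refine ⟨⟨a, Isometry.of_dist_eq fun s t => ?_⟩, rfl, Subtype.ext (funext fun t => ?_)⟩
  · rw [hv, hv1, one_mul, NNReal.dist_eq]
  · change a t = a (1 * t)
    rw [one_mul]

end InfinityCone

end Cone

/-! ### Hemispheres at infinity -/

section Hemisphere

variable {Y : Type u} [MetricSpace Y]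

/-- The closed horoball centered at the endpoint of `σ` that has the initial point of `σ` on its
boundary: the set where the Busemann function of `σ` is non-positive. -/
def horoball (σ : GeodesicRay Y) : Set Y :=
  {y | ∀ ε : ℝ, 0 < ε → ∀ᶠ T : ℝ≥0 in atTop, dist y (σ.1 T) ≤ T + ε}

theorem zero_mem_horoball (σ : GeodesicRay Y) : σ.1 0 ∈ horoball σ := fun ε hε =>
  Eventually.of_forall fun T => by rw [σ.dist_zero]; linarith

theorem isClosed_horoball (σ : GeodesicRay Y) : IsClosed (horoball σ) := by
  refine isClosed_of_closure_subset fun y hy ε hε => ?_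
  obtain ⟨z, hz, hyz⟩ := Metric.mem_closure_iff.1 hy (ε / 2) (by linarith)
  filter_upwards [hz (ε / 2) (by linarith)] with T hT
  linarith [dist_triangle y z (σ.1 T)]

theorem IsHadamard.geodConvex_horoball (hY : IsHadamard Y) (σ : GeodesicRay Y) :
    GeodConvex (horoball σ) := by
  refine hY.geodConvex_of_seg fun x hx y hy t ht ε hε => ?_
  filter_upwards [hx ε hε, hy ε hε] with T h1 h2
  refine (hY.dist_seg_le x y (σ.1 T) ht).trans ?_
  have h3 := mul_le_mul_of_nonneg_left h1 (sub_nonneg.2 ht.2)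
  have h4 := mul_le_mul_of_nonneg_left h2 ht.1
  linarith

namespace GeodesicRay

theorem cosInf_nonneg_of_mem_horoball (hY : IsHadamard Y) {ξ σ : GeodesicRay Y}
    (h0 : ξ.1 0 = σ.1 0) (h : ∀ t, ξ.1 t ∈ horoball σ) : 0 ≤ cosInf ξ σ := by
  refine le_cosInf fun t ht => le_of_forall_pos_le_add fun ε hε => ?_
  have ht' : (0 : ℝ) < t := ht
  obtain ⟨T, h1, h2, h3⟩ := ((h t (ε * t / 2) (by positivity)).and ((eventually_ge_atTop t).and
    ((NNReal.tendsto_coe_atTop.2 tendsto_id).eventually_ge_atTop (ε * t / 2)))).exists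
  have hT : 0 < T := ht.trans_le h2
  have hT' : (0 : ℝ) < T := hT
  rw [id] at h3
  suffices -ε ≤ compCos ξ σ t T by linarith [compCos_le hY h0 ht le_rfl ht h2]
  rw [compCos, le_div_iff₀ (by positivity)]
  have h4 : dist (ξ.1 t) (σ.1 T) ^ 2 ≤ (T + ε * t / 2) ^ 2 := by gcongr
  have h5 : (ε * t / 2) * (ε * t / 2) ≤ (ε * t / 2) * T := by gcongr
  have h6 : 0 < ε * t * T := by positivity
  nlinarith [sq_nonneg (t : ℝ)]

theorem cosInf_self (ρ : GeodesicRay Y) : cosInf ρ ρ = 1 := by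
  have : Nonempty (Ioi (0 : ℝ≥0)) := ⟨⟨1, mem_Ioi.2 zero_lt_one⟩⟩
  have h : ∀ t : Ioi (0 : ℝ≥0), compCos ρ ρ t t = 1 := by
    intro t
    have ht : (0 : ℝ) < (t : ℝ≥0) := t.2
    rw [compCos, dist_self]
    field_simp
    ring
  simp only [cosInf, h, ciInf_const]

end GeodesicRay

namespace InfinityCone

variable {o : Y}

theorem coneDist_nonneg (a b : InfinityCone o) : 0 ≤ coneDist a b :=
  Real.iSup_nonneg fun t => by positivity

theorem ofRay_one_injective {ρ σ : GeodesicRay Y} {hρ : ρ.1 0 = o} {hσ : σ.1 0 = o}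
    (h : ofRay ρ hρ 1 = ofRay σ hσ 1) : ρ = σ := by
  refine Subtype.ext (funext fun t => ?_)
  have := congrFun (congrArg Subtype.val h) t
  change ρ.1 (1 * t) = σ.1 (1 * t) at this
  rwa [one_mul] at this

end InfinityCone

open GeodesicRay InfinityCone

/-- If two rays span a line in the cone at infinity, the asymptotic angles that they make with a
third ray add up to at least `π`. -/
theorem cosInf_add_cosInf_le [ProperSpace Y] (hY : IsHadamard Y) {ξ σ τ : GeodesicRay Y} {o : Y}
    (hξ : ξ.1 0 = o) (hσ : σ.1 0 = o) (hτ : τ.1 0 = o) (h : cosInf σ τ = -1) :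
    cosInf ξ σ + cosInf ξ τ ≤ 0 := by
  obtain ⟨m, hm⟩ := exists_midpoint hY (ofRay σ hσ 1) (ofRay τ hτ 1)
  have h1 := hm (ofRay ξ hξ 0)
  have h2 := hm (ofRay ξ hξ 1)
  have hs := coneDist_ofRay_sq hY hσ hτ 1 1
  rw [h] at hs
  rw [coneDist_ofRay_sq hY, coneDist_ofRay_sq hY, hs] at h1
  rw [coneDist_ofRay_sq hY, coneDist_ofRay_sq hY, hs] at h2
  push_cast at h1 h2
  have h3 : coneDist (ofRay ξ hξ 0) m ^ 2 ≤ 0 := by linarith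
  have h4 : coneDist (ofRay ξ hξ 0) m = 0 :=
    pow_eq_zero_iff two_ne_zero |>.1 (le_antisymm h3 (sq_nonneg _))
  have h5 : ofRay ξ hξ 0 = m := (metricSpace hY o).eq_of_dist_eq_zero h4
  rw [← h5, coneDist_ofRay_sq hY, cosInf_self] at h2
  push_cast at h2
  linarith

/-- A unit sphere at infinity all points of which have Tits angle at most `π / 2` from the endpoint
of a ray `ξ` bounds a unit hemisphere: the angles are equal to `π / 2`, as opposite points of the
sphere have angle `π`, and the cone over the sphere and `ξ` span a half-space in the cone at
infinity. -/
theorem boundsUnitHemisphere_of_cosInf_nonneg [ProperSpace Y] (hY : IsHadamard Y) {o : Y} {d : ℕ}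
    {f : EuclideanSpace ℝ (Fin (d + 1)) → IdealBoundary Y}
    (hf : TitsIsometricOn f (Metric.sphere 0 1))
    {σ : EuclideanSpace ℝ (Fin (d + 1)) → GeodesicRay Y} (hσ0 : ∀ u, (σ u).1 0 = o)
    (hσ : ∀ u, (σ u).endpoint = f u) {ξ : GeodesicRay Y} (hξ : ξ.1 0 = o)
    (h : ∀ u ∈ Metric.sphere (0 : EuclideanSpace ℝ (Fin (d + 1))) 1, 0 ≤ cosInf ξ (σ u)) :
    BoundsUnitHemisphere (f '' Metric.sphere 0 1) := by
  have hcos : ∀ u w : EuclideanSpace ℝ (Fin (d + 1)), ‖u‖ = 1 → ‖w‖ = 1 →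
      cosInf (σ u) (σ w) = inner ℝ u w := by
    intro u w hu hw
    have h0 : (σ u).1 0 = (σ w).1 0 := by rw [hσ0, hσ0]
    have h1 := hf u (by simpa using hu) w (by simpa using hw)
    rw [← hσ, ← hσ, titsAngle_eq hY h0] at h1
    have h2 := congrArg Real.cos h1
    have h3 := abs_le.1 (abs_cosInf_le hY h0)
    rwa [Real.cos_arccos h3.1 h3.2, InnerProductGeometry.cos_angle, hu, hw, mul_one,
      div_one] at h2
  have hzero : ∀ u : EuclideanSpace ℝ (Fin (d + 1)), ‖u‖ = 1 → cosInf ξ (σ u) = 0 := by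
    intro u hu
    have h1 := h u (by simpa using hu)
    have h2 := h (-u) (by simpa using hu)
    have h3 := cosInf_add_cosInf_le hY hξ (hσ0 u) (hσ0 (-u)) (by
      rw [hcos u (-u) hu (by rwa [norm_neg]), inner_neg_right, real_inner_self_eq_norm_sq, hu]
      norm_num)
    linarith
  let _ := metricSpace hY o
  have hunit : ∀ v : EuclideanSpace ℝ (Fin (d + 1)), v ≠ 0 → ‖‖v‖⁻¹ • v‖ = 1 := fun v hv => by
    rw [norm_smul, norm_inv, norm_norm, inv_mul_cancel₀ (norm_ne_zero_iff.2 hv)]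
  set fc : EuclideanSpace ℝ (Fin (d + 1)) → InfinityCone o := fun v =>
    ofRay (σ (‖v‖⁻¹ • v)) (hσ0 _) ‖v‖₊ with hfc
  set gc : ℝ → InfinityCone o := fun t => ofRay ξ hξ t.toNNReal
  have h1 : ∀ v w, dist (fc v) (fc w) = ‖v - w‖ := by
    intro v w
    refine (pow_left_inj₀ dist_nonneg (norm_nonneg _) two_ne_zero).1 ?_
    refine (coneDist_ofRay_sq hY (hσ0 _) (hσ0 _) _ _).trans ?_
    rw [coe_nnnorm, coe_nnnorm, norm_sub_sq_real]
    by_cases hv : v = 0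
    · simp [hv]
    by_cases hw : w = 0
    · simp [hw]
    rw [hcos _ _ (hunit v hv) (hunit w hw), inner_smul_left, inner_smul_right]
    have := norm_ne_zero_iff.2 hv
    have := norm_ne_zero_iff.2 hw
    simp only [conj_trivial]
    field_simp
    ring
  have h2 : ∀ t t' : ℝ, 0 ≤ t → 0 ≤ t' → dist (gc t) (gc t') = |t - t'| := by
    intro t t' ht ht'
    refine (pow_left_inj₀ dist_nonneg (abs_nonneg _) two_ne_zero).1 ?_
    refine (coneDist_ofRay_sq hY hξ hξ _ _).trans ?_
    rw [Real.coe_toNNReal t ht, Real.coe_toNNReal t' ht', cosInf_self, sq_abs]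
    ring
  have h3 : ∀ (t : ℝ) v, 0 ≤ t → dist (gc t) (fc v) ^ 2 = t ^ 2 + ‖v‖ ^ 2 := by
    intro t v ht
    refine (coneDist_ofRay_sq hY hξ (hσ0 _) _ _).trans ?_
    rw [Real.coe_toNNReal t ht, coe_nnnorm]
    by_cases hv : v = 0
    · simp [hv]
    · rw [hzero _ (hunit v hv)]; ring
  obtain ⟨F, hF0, hF⟩ := exists_halfSpace (exists_midpoint hY) h1 h2 h3
  -- the splitting of a vector into its first `d + 1` coordinates and its last one
  set pr : EuclideanSpace ℝ (Fin (d + 2)) → EuclideanSpace ℝ (Fin (d + 1)) := fun v =>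
    WithLp.toLp 2 fun i => v i.castSucc with hpr
  have hnorm : ∀ v : EuclideanSpace ℝ (Fin (d + 2)),
      ‖v‖ ^ 2 = ‖pr v‖ ^ 2 + v (Fin.last (d + 1)) ^ 2 := by
    intro v
    rw [EuclideanSpace.real_norm_sq_eq, EuclideanSpace.real_norm_sq_eq, Fin.sum_univ_castSucc]
  have hsub : ∀ v w, pr (v - w) = pr v - pr w := fun v w => rfl
  have hray : ∀ v : EuclideanSpace ℝ (Fin (d + 2)), ‖v‖ = 1 → 0 ≤ v (Fin.last (d + 1)) →
      ∃ (ρ : GeodesicRay Y) (hρ : ρ.1 0 = o), F (pr v) (v (Fin.last (d + 1))) = ofRay ρ hρ 1 := by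
    intro v hv hv0
    refine exists_eq_ofRay (b := fc 0) (fun t => ?_) ?_
    · change (σ _).1 (‖(0 : EuclideanSpace ℝ (Fin (d + 1)))‖₊ * t) = o
      rw [nnnorm_zero, zero_mul, hσ0]
    · refine (pow_left_inj₀ (coneDist_nonneg _ _) zero_le_one two_ne_zero).1 ?_
      have := hF (pr v) 0 (v (Fin.last (d + 1))) 0 hv0 le_rfl
      rw [hF0, sub_zero, sub_zero, ← hnorm, hv] at this
      exact this
  classical
  set G : EuclideanSpace ℝ (Fin (d + 2)) → IdealBoundary Y := fun v =>
    if hv : ‖v‖ = 1 ∧ 0 ≤ v (Fin.last (d + 1)) then (hray v hv.1 hv.2).choose.endpoint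
    else f 0 with hG
  have hGray : ∀ v : EuclideanSpace ℝ (Fin (d + 2)), ‖v‖ = 1 → 0 ≤ v (Fin.last (d + 1)) →
      ∃ (ρ : GeodesicRay Y) (hρ : ρ.1 0 = o), F (pr v) (v (Fin.last (d + 1))) = ofRay ρ hρ 1 ∧
        G v = ρ.endpoint := by
    intro v hv hv0
    obtain ⟨h4, h5⟩ := (hray v hv hv0).choose_spec
    exact ⟨_, h4, h5, dif_pos ⟨hv, hv0⟩⟩
  have hGf : ∀ v : EuclideanSpace ℝ (Fin (d + 2)), ‖v‖ = 1 → v (Fin.last (d + 1)) = 0 →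
      G v = f (pr v) := by
    intro v hv hv0
    obtain ⟨ρ, hρ, h4, h5⟩ := hGray v hv hv0.ge
    have hn := hnorm v
    rw [hv, hv0] at hn
    have hn1 : ‖pr v‖ = 1 :=
      (pow_left_inj₀ (norm_nonneg _) zero_le_one two_ne_zero).1 (by linarith)
    have h6 : fc (pr v) = ofRay (σ (pr v)) (hσ0 _) 1 := by
      have e1 : ‖pr v‖⁻¹ • pr v = pr v := by rw [hn1, inv_one, one_smul]
      have e2 : ‖pr v‖₊ = 1 := NNReal.eq hn1
      simp only [hfc, e1, e2]
    rw [hv0, hF0, h6] at h4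
    rw [h5, ← ofRay_one_injective h4, hσ]
  refine ⟨d, G, ?_, ?_⟩
  · rintro v ⟨hv, hv0⟩ w ⟨hw, hw0⟩
    obtain ⟨ρ, hρ, h4, h5⟩ := hGray v hv hv0
    obtain ⟨τ, hτ, h6, h7⟩ := hGray w hw hw0
    rw [h5, h7, titsAngle_eq hY (hρ.trans hτ.symm), InnerProductGeometry.angle, hv, hw, mul_one,
      div_one]
    congr 1
    have h8 := hF (pr v) (pr w) (v (Fin.last (d + 1))) (w (Fin.last (d + 1))) hv0 hw0
    have h9 := hnorm (v - w)
    rw [hsub, norm_sub_sq_real, hv, hw] at h9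
    rw [h4, h6] at h8
    have h10 := (coneDist_ofRay_sq hY hρ hτ 1 1).symm.trans h8
    have h11 : (v - w) (Fin.last (d + 1)) = v (Fin.last (d + 1)) - w (Fin.last (d + 1)) := rfl
    rw [h11] at h9
    push_cast at h10
    linarith
  · ext η
    constructor
    · rintro ⟨v, ⟨hv, hv0⟩, rfl⟩
      have hn := hnorm v
      rw [hv, hv0] at hn
      refine ⟨pr v, ?_, (hGf v hv hv0).symm⟩
      rw [mem_sphere_zero_iff_norm]
      exact (pow_left_inj₀ (norm_nonneg _) zero_le_one two_ne_zero).1 (by linarith)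
    · rintro ⟨u, hu, rfl⟩
      rw [mem_sphere_zero_iff_norm] at hu
      set v : EuclideanSpace ℝ (Fin (d + 2)) :=
        WithLp.toLp 2 (Fin.snoc (α := fun _ => ℝ) (fun i => u i) 0) with hv
      have hv0 : v (Fin.last (d + 1)) = 0 := by simp [hv]
      have hpv : pr v = u := by ext i; simp [hpr, hv]
      have hn := hnorm v
      rw [hpv, hu, hv0] at hn
      have hv1 : ‖v‖ = 1 :=
        (pow_left_inj₀ (norm_nonneg _) zero_le_one two_ne_zero).1 (by linarith)
      exact ⟨v, ⟨hv1, hv0⟩, by rw [hGf v hv1 hv0, hpv]⟩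

/-! ### Existence of minimal elements -/

variable {A : Set (IdealBoundary Y)}

/-- If `A` contains a unit sphere that does not bound a unit hemisphere, the members of the family
stay close to each point `o`. Otherwise the projections of `o` to a sequence of members that tends
to infinity lie in all horoballs through `o` that are centered on the sphere, and so does a limit
ray, whose endpoint thus has angle at most `π / 2` from the points of the sphere. -/
theorem exists_infDist_le_of_sphere [ProperSpace Y] (hY : IsHadamard Y)
    (hA : ∃ s, s ⊆ A ∧ IsUnitSphere s ∧ ¬ BoundsUnitHemisphere s) (o : Y) :
    ∃ R : ℝ, ∀ C ∈ convexFamily A, Metric.infDist o C ≤ R := by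
  obtain ⟨s, hsA, ⟨d, f, hf, rfl⟩, hs⟩ := hA
  by_contra! hne
  have hex : ∀ η : IdealBoundary Y, ∃ σ : GeodesicRay Y, σ.1 0 = o ∧ σ.endpoint = η := by
    intro η
    obtain ⟨τ, rfl⟩ := Quotient.exists_rep η
    obtain ⟨σ, h0, h1⟩ := hY.exists_asymptotic o τ
    exact ⟨σ, h0, endpoint_eq_iff.2 h1⟩
  choose σ hσ0 hσ using fun u => hex (f u)
  set S : Set Y := ⋂ u : Metric.sphere (0 : EuclideanSpace ℝ (Fin (d + 1))) 1, horoball (σ u)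
    with hS
  have hoS : o ∈ S := mem_iInter.2 fun u => by
    have := zero_mem_horoball (σ u); rwa [hσ0] at this
  have hunb : ∀ r : ℝ, ∃ y ∈ S, r < dist o y := by
    intro r
    obtain ⟨C, hC, hr⟩ := hne r
    obtain ⟨h1, h2⟩ := nearestPt_spec hC.1 hC.2.1 o
    refine ⟨nearestPt C o, mem_iInter.2 fun u ε hε => ?_, by rwa [← h2]⟩
    obtain ⟨τ', hτ', he⟩ := hC.2.2.2 (hsA ⟨u, u.2, rfl⟩)
    obtain ⟨τ, hτ0, hττ, hτC⟩ := hY.exists_asymptotic_mem hC.2.1 hC.2.2.1 h1 τ' hτ'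
    have has : Asymptotic (σ u) τ := endpoint_eq_iff.1
      ((hσ u).trans (he.symm.trans (endpoint_eq_iff.2 hττ).symm))
    filter_upwards [eventually_dist_add_dist_le hY has hε] with T hT
    rw [hτ0, hσ0] at hT
    have h3 := hY.pythagoras_le hC.2.2.1 h1 h2 (hτC T)
    have h4 := τ.dist_zero T
    rw [hτ0] at h4
    rw [h4] at h3
    have h5 : (T : ℝ) ≤ dist o (τ.1 T) :=
      le_of_sq_le_sq (by nlinarith [sq_nonneg (dist o (nearestPt C o))]) dist_nonneg
    linarith
  obtain ⟨ξ, hξ0, hξ⟩ := hY.exists_ray_of_unbounded (isClosed_iInter fun u => isClosed_horoball _)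
    (GeodConvex.iInter fun u => hY.geodConvex_horoball _) hoS hunb
  exact hs (boundsUnitHemisphere_of_cosInf_nonneg hY hf hσ0 hσ hξ0 fun u hu =>
    cosInf_nonneg_of_mem_horoball hY (by rw [hξ0, hσ0])
      fun t => mem_iInter.1 (hξ t) ⟨u, hu⟩)

theorem exists_isMinimalFor_of_infDist_le [ProperSpace Y] (hY : IsHadamard Y) {o : Y} {R : ℝ}
    (hR : ∀ C ∈ convexFamily A, Metric.infDist o C ≤ R) : ∃ C, IsMinimalFor A C := by
  refine zorn_superset (convexFamily A) fun c hc hchain => ?_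
  rcases c.eq_empty_or_nonempty with rfl | ⟨C₀, hC₀⟩
  · exact ⟨univ, hY.mem_convexFamily isClosed_univ (fun _ _ _ _ _ _ => mem_univ _)
      ⟨o, mem_univ o⟩ fun _ _ _ _ => mem_univ _, by simp⟩
  have hne : (⋂₀ c).Nonempty := by
    have : Nonempty c := ⟨⟨C₀, hC₀⟩⟩
    have h := IsCompact.nonempty_iInter_of_directed_nonempty_isCompact_isClosed
      (fun C : c => (C : Set Y) ∩ Metric.closedBall o R)
      (fun C D => by
        rcases hchain.total C.2 D.2 with h | h
        · exact ⟨C, Subset.rfl, inter_subset_inter_left _ h⟩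
        · exact ⟨D, inter_subset_inter_left _ h, Subset.rfl⟩)
      (fun C => by
        obtain ⟨h1, h2⟩ := nearestPt_spec (hc C.2).1 (hc C.2).2.1 o
        refine ⟨_, h1, ?_⟩
        rw [Metric.mem_closedBall, dist_comm, ← h2]
        exact hR _ (hc C.2))
      (fun C => (isCompact_closedBall o R).inter_left (hc C.2).2.1)
      (fun C => (hc C.2).2.1.inter Metric.isClosed_closedBall)
    obtain ⟨x, hx⟩ := h
    exact ⟨x, mem_sInter.2 fun C hC => (mem_iInter.1 hx ⟨C, hC⟩).1⟩
  refine ⟨⋂₀ c, hY.mem_convexFamily (isClosed_sInter fun C hC => (hc hC).2.1) ?_ hne ?_,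
    fun C hC => sInter_subset_of_mem hC⟩
  · rw [sInter_eq_iInter]
    exact GeodConvex.iInter fun C => (hc C.2).2.2.1
  · intro ρ hρ h0 t
    refine mem_sInter.2 fun C hC => ?_
    have h1 := hY.infDist_ray_le (hc hC) ρ hρ t
    rw [Metric.infDist_zero_of_mem (mem_sInter.1 h0 C hC)] at h1
    exact ((hc hC).2.1.mem_iff_infDist_zero (hc hC).1).2 (h1.antisymm Metric.infDist_nonneg)

end Hemisphere

theorem mainTheorem10 (Y : Type u) [MetricSpace Y] [LocallyCompactSpace Y] (hY : IsHadamard Y)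
    (A : Set (IdealBoundary Y)) :
    -- existence of minimal elements
    ((∃ s, s ⊆ A ∧ IsUnitSphere s ∧ ¬ BoundsUnitHemisphere s) → ∃ C, IsMinimalFor A C) ∧
    -- structure of the union of the minimal elements
    ((∃ C, IsMinimalFor A C) →
      GeodConvex (minimalUnion A) ∧
      ∀ C : Set Y, IsMinimalFor A C →
        ∃ (Z : Type u) (_ : MetricSpace Z) (φ : WithLp 2 (C × Z) ≃ᵢ minimalUnion A),
          IsHadamard Z ∧ LayersAreMinimal A φ ∧
          ((∃ s, s ⊆ A ∧ IsUnitSphere s ∧ ¬ BoundsUnitHemisphere s) ∨ A = univ →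
            CompactSpace Z)) ∧
    -- the central minimal convex subset
    ((∃ s, s ⊆ A ∧ IsUnitSphere s ∧ ¬ BoundsUnitHemisphere s) → ∃! K, IsCentralMinimal A K) ∧
    -- the convex core
    ((∃ C, IsMinimalFor (univ : Set (IdealBoundary Y)) C) → ∃! K : Set Y, IsConvexCore K) := by
  have := hY.properSpace
  obtain ⟨o⟩ := hY.nonempty
  have hex : (∃ s, s ⊆ A ∧ IsUnitSphere s ∧ ¬ BoundsUnitHemisphere s) → ∃ C, IsMinimalFor A C :=
    fun hA => by
      obtain ⟨R, hR⟩ := exists_infDist_le_of_sphere hY hA o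
      exact exists_isMinimalFor_of_infDist_le hY hR
  refine ⟨hex, fun _ => ⟨hY.geodConvex_minimalUnion, fun C hC => ?_⟩, fun hA => ?_, ?_⟩
  · obtain ⟨c, hc⟩ := hC.1.1
    obtain ⟨φ, hφ⟩ := hC.exists_product hY hc
    refine ⟨slice A C c, inferInstance, φ, hC.isHadamard_slice hY hc, hφ, ?_⟩
    rintro (hA | rfl)
    · obtain ⟨R, hR⟩ := exists_infDist_le_of_sphere hY hA o
      exact hC.compactSpace_slice hY fun z hz => hC.dist_slice_le hY hR hz
    · obtain ⟨r, hr⟩ := hC.exists_dist_slice_le_of_univ hY hc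
      exact hC.compactSpace_slice hY hr
  · obtain ⟨C, hC⟩ := hex hA
    obtain ⟨c, hc⟩ := hC.1.1
    obtain ⟨R, hR⟩ := exists_infDist_le_of_sphere hY hA o
    exact hC.existsUnique_isCentralMinimal hY hc fun z hz => hC.dist_slice_le hY hR hz
  · rintro ⟨C, hC⟩
    obtain ⟨c, hc⟩ := hC.1.1
    obtain ⟨r, hr⟩ := hC.exists_dist_slice_le_of_univ hY hc
    exact hC.existsUnique_isCentralMinimal hY hc hr
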